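/- **Setting.** Let $r,\rho\ge 1$ be integers and let $\mathcal E$ be an evolution equation $u_t=H(t,x,u_0,u_1,\dots,u_r)$, where $u_0=u$, $u_k=\partial^k u/\partial x^k$, and $H$ is a smooth real function on an open set with $\partial H/\partial u_r\ne0$. The indices $a,b$ run from $1$ to $\rho$, smooth means $C^\infty$, and everything is local: functions are defined and equations hold in neighbourhoods of given points. For a function $\check\eta=\check\eta(t,x,u_0,\dots,u_{\rho-1})$ put $$\hat D_x=\partial_x+\sum_{b=1}^{\rho-1}u_b\,\partial_{u_{b-1}}+\check\eta\,\partial_{u_{\rho-1}},\qquad \hat D_t=\partial_t+\sum_{b=1}^{\rho}(\hat D_x^{\,b-1}\hat H)\,\partial_{u_{b-1}},$$ where $\hat H$ is obtained from $H$ by substituting $\hat D_x^{\,k}\check\eta$ for $u_{\rho+k}$, $0\le k\le r-\rho$ (so $\hat H=H$ if $\rho>r$). The *determining system* for a tuple $\bar\theta=(\theta^1,\dots,\theta^\rho)$ of functions of $(t,x,u_0,\dots,u_{\rho-1})$ consists of the determining equation $\hat D_t\check\eta=\hat D_x^{\,\rho}\hat H$, where $\check\eta=\theta^\rho$, and of the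 equations $\theta^a=u_a$, $a=1,\dots,\rho-1$. The *initial system* for a tuple $(v^0,\dots,v^{\rho-1})$ of functions of $(\tilde t,\tilde x,\varkappa_1,\dots,\varkappa_\rho)$ consists of the equation $\mathcal E$ for $\tilde u=v^0$ as a function of $(\tilde t,\tilde x)$, with $\bar\varkappa=(\varkappa_1,\dots,\varkappa_\rho)$ as parameters, and of the equations $v^{b-1}=\partial^{b-1}\tilde u/\partial\tilde x^{b-1}$, $b=2,\dots,\rho$. Consider the differential substitution $$\bar\theta=-\Psi^{-1}\bar{\mathcal I}_x,\qquad \Psi=\bigl(\partial\mathcal I^a/\partial u_{b-1}\bigr),\quad \det\Psi\neq0,$$ where $\bar{\mathcal I}=(\mathcal I^1,\dots,\mathcal I^\rho)$ is a tuple of functions of $(t,x,u_0,\dots,u_{\rho-1})$, and the hodograph transformation with the new independent variables $\tilde t=t$, $\tilde x=x$, $\varkappa_a=\mathcal I^a$ and the new dependent variables $v^{b-1}=u_{b-1}$ (that is, $(t,x,\bar u)\mapsto(t,x,\bar{\mathcal I})$ and $(\tilde t,\tilde x,\bar\varkappa)\mapsto(\tilde t,\tilde x,\bar v)$ are mutually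 inverse, where $\bar u=(u_0,\dots,u_{\rho-1})$ and $\bar v=(v^0,\dots,v^{\rho-1})$). **Theorem.** The composition of the differential substitution with the hodograph transformation reduces the determining system to the initial system. Precisely, for smooth tuples of functions near given points: 1. Every $\bar\theta$ is locally of the form $-\Psi^{-1}\bar{\mathcal I}_x$ with $\det\Psi\ne0$. If $\bar{\mathcal I}$ is one such tuple, then the others are exactly the tuples $\bar G(t,\bar{\mathcal I})$, where $\bar G$ is smooth and invertible with respect to its last $\rho$ arguments. 2. For every $\bar{\mathcal I}$ with $\det\Psi\ne0$ the hodograph transformation locally defines a smooth tuple $\bar v$. Conversely, for every $\bar v$ with $\det(\partial v^{b-1}/\partial\varkappa_a)\neq0$ the inverse hodograph transformation locally defines a smooth $\bar{\mathcal I}$ with $\det\Psi\ne0$, and so a smooth tuple $\bar\theta=-\Psi^{-1}\bar{\mathcal I}_x$. 3. Let $\bar\theta$, $\bar{\mathcal I}$ and $\bar v$ be related by the two transformations. Then * $\theta^a=u_a$ for all $a<\rho$ if and only if $v^{b-1}=\partial^{b-1}v^0/\partial\tilde x^{b-1}$ for all $b$; * if $\bar v$ solves the initial system, then $\bar\theta$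 solves the determining system; * if $\bar\theta$ solves the determining system, then, after $\bar{\mathcal I}$ is replaced by $\bar G(t,\bar{\mathcal I})$ for some smooth $\bar G$ that is invertible with respect to its last $\rho$ arguments (which does not change $\bar\theta$), the corresponding tuple $\bar v$ solves the initial system. 4. If solutions $\bar v$ and $\bar v'$ of the initial system correspond to the same $\bar\theta$, then the families $\tilde u=v^0$ and $\tilde u'=v'^0$ differ only by their parametrization: $\tilde u'(\tilde t,\tilde x,\bar\zeta(\bar\varkappa))=\tilde u(\tilde t,\tilde x,\bar\varkappa)$ with a smooth, locally invertible $\bar\zeta$. Hence solving the determining equation is locally equivalent to finding the $\rho$-parametric families of solutions of $\mathcal E$ with $\det(\partial^b\tilde u/\partial\tilde x^{b-1}\partial\varkappa_a)\ne0$, up to re-parametrization. -/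

import Mathlib

open Filter Topology
open scoped ContDiff

/-- An evolution equation `u_t = H(t, x, u_0, …, u_r)`: `H` is smooth on an open set of points
`(t, x, (u_0, …, u_r))`, and `∂H/∂u_r` vanishes nowhere on it. -/
structure EvolutionEquation (r : ℕ) where
  domain : Set (ℝ × ℝ × (Fin (r + 1) → ℝ))
  isOpen_domain : IsOpen domain
  H : ℝ × ℝ × (Fin (r + 1) → ℝ) → ℝ
  smooth_H : ContDiffOn ℝ ∞ H domain
  order_eq : ∀ z ∈ domain, fderiv ℝ H z (0, 0, Pi.single (Fin.last r) 1) ≠ 0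

/-- Points `(t, x, (u_0, …, u_{ρ-1}))`, and also points `(t̃, x̃, (ϰ_1, …, ϰ_ρ))`.
Component number `a` of a `ρ`-tuple counted from `1` has the index `a - 1` in `Fin ρ`. -/
abbrev Pt (ρ : ℕ) : Type := ℝ × ℝ × (Fin ρ → ℝ)

/-- `f` is smooth (infinitely differentiable) in a neighbourhood of `p₀`. -/
def SmoothNear {X Y : Type*} [NormedAddCommGroup X] [NormedSpace ℝ X]
    [NormedAddCommGroup Y] [NormedSpace ℝ Y] (f : X → Y) (p₀ : X) : Prop :=
  ∀ᶠ p in 𝓝 p₀, ContDiffAt ℝ ∞ f p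

section Operators

variable {ρ : ℕ} {Y : Type*} [NormedAddCommGroup Y] [NormedSpace ℝ Y]

/-- Partial derivative with respect to the first variable (`t`). -/
noncomputable def pdT (f : Pt ρ → Y) (p : Pt ρ) : Y := fderiv ℝ f p (1, 0, 0)

/-- Partial derivative with respect to the second variable (`x`). -/
noncomputable def pdX (f : Pt ρ → Y) (p : Pt ρ) : Y := fderiv ℝ f p (0, 1, 0)

/-- Partial derivative with respect to component `b` of the last argument
(`u_b`, respectively `ϰ_{b+1}`). -/
noncomputable def pdU (b : Fin ρ) (f : Pt ρ → Y) (p : Pt ρ) : Y :=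
  fderiv ℝ f p (0, 0, Pi.single b 1)

/-- The Jacobian matrix of a tuple of functions with respect to the last argument; for
`F = 𝓘` it is `Ψ = (∂𝓘^a/∂u_{b-1})`. -/
noncomputable def jac (F : Pt ρ → (Fin ρ → ℝ)) (p : Pt ρ) : Matrix (Fin ρ) (Fin ρ) ℝ :=
  Matrix.of fun a b => pdU b F p a

/-- `D̂_x = ∂_x + ∑_{b<ρ} u_b ∂_{u_{b-1}} + η ∂_{u_{ρ-1}}`. -/
noncomputable def hatDx (η : Pt ρ → ℝ) (f : Pt ρ → ℝ) (p : Pt ρ) : ℝ :=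
  pdX f p + ∑ b : Fin ρ,
    (if h : (b : ℕ) + 1 < ρ then p.2.2 ⟨(b : ℕ) + 1, h⟩ else η p) * pdU b f p

/-- `û_k`, the expression of `u_k` on the manifold given by `u_ρ = η` and its consequences with
respect to `x`: `u_k` for `k < ρ` and `D̂_x^{k-ρ} η` for `k ≥ ρ`. -/
noncomputable def hatU (η : Pt ρ → ℝ) (k : ℕ) (p : Pt ρ) : ℝ :=
  if h : k < ρ then p.2.2 ⟨k, h⟩ else (hatDx η)^[k - ρ] η p

/-- The point `(t, x, û_0, …, û_r)`. -/
noncomputable def hatJet (r : ℕ) (η : Pt ρ → ℝ) (p : Pt ρ) : ℝ × ℝ × (Fin (r + 1) → ℝ) :=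
  (p.1, p.2.1, fun k => hatU η k p)

/-- `Ĥ`: the function `H` with `u_ρ, u_{ρ+1}, …` replaced by `η, D̂_x η, …`. -/
noncomputable def hatH {r : ℕ} (E : EvolutionEquation r) (η : Pt ρ → ℝ) (p : Pt ρ) : ℝ :=
  E.H (hatJet r η p)

/-- `D̂_t = ∂_t + ∑_b (D̂_x^{b-1} Ĥ) ∂_{u_{b-1}}`. -/
noncomputable def hatDt {r : ℕ} (E : EvolutionEquation r) (η : Pt ρ → ℝ) (f : Pt ρ → ℝ)
    (p : Pt ρ) : ℝ :=
  pdT f p + ∑ b : Fin ρ, (hatDx η)^[(b : ℕ)] (hatH E η) p * pdU b f p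

/-- The determining equation `D̂_t η = D̂_x^ρ Ĥ` at the point `p`. -/
def DeterminingEqAt {r : ℕ} (E : EvolutionEquation r) (η : Pt ρ → ℝ) (p : Pt ρ) : Prop :=
  hatDt E η η p = (hatDx η)^[ρ] (hatH E η) p

/-- The algebraic equations `θ^a = u_a`, `a = 1, …, ρ - 1`, near `p₀`. -/
def AlgebraicEqs (θ : Pt ρ → (Fin ρ → ℝ)) (p₀ : Pt ρ) : Prop :=
  ∀ᶠ p in 𝓝 p₀, ∀ (a : ℕ) (h : a + 1 < ρ), θ p ⟨a, by omega⟩ = p.2.2 ⟨a + 1, h⟩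

/-- The last component `θ^ρ` of a `ρ`-tuple of functions. -/
def lastComp [NeZero ρ] (θ : Pt ρ → (Fin ρ → ℝ)) (p : Pt ρ) : ℝ :=
  θ p ⟨ρ - 1, Nat.sub_lt (NeZero.pos ρ) Nat.one_pos⟩

/-- The tuple `θ` solves, near `p₀`, the system that consists of the determining equation for
`θ^ρ` and of the equations `θ^a = u_a`, `a < ρ` (in particular `Ĥ` is defined near `p₀`). -/
def SolvesDeterminingSystem [NeZero ρ] {r : ℕ} (E : EvolutionEquation r)
    (θ : Pt ρ → (Fin ρ → ℝ)) (p₀ : Pt ρ) : Prop :=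
  AlgebraicEqs θ p₀ ∧
    ∀ᶠ p in 𝓝 p₀, hatJet r (lastComp θ) p ∈ E.domain ∧ DeterminingEqAt E (lastComp θ) p

/-- The function `ũ = v^0`. -/
def tildeU [NeZero ρ] (v : Pt ρ → (Fin ρ → ℝ)) (q : Pt ρ) : ℝ := v q 0

/-- The equations `v^{b-1} = ∂^{b-1}ũ/∂x̃^{b-1}`, where `ũ = v^0`, near `q₀`
(for `b = 1` the equation is trivial). -/
def DerivativeEqs [NeZero ρ] (v : Pt ρ → (Fin ρ → ℝ)) (q₀ : Pt ρ) : Prop :=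
  ∀ᶠ q in 𝓝 q₀, ∀ b : Fin ρ, v q b = pdX^[(b : ℕ)] (tildeU v) q

/-- The point `(t̃, x̃, ũ, ∂ũ/∂x̃, …, ∂^rũ/∂x̃^r)`. -/
noncomputable def xJet (r : ℕ) (u : Pt ρ → ℝ) (q : Pt ρ) : ℝ × ℝ × (Fin (r + 1) → ℝ) :=
  (q.1, q.2.1, fun k => pdX^[(k : ℕ)] u q)

/-- The function `u(t̃, x̃, ϰ)` satisfies the evolution equation near `q₀`,
with `ϰ` as a tuple of parameters. -/
def SolvesEvolutionEq {r : ℕ} (E : EvolutionEquation r) (u : Pt ρ → ℝ) (q₀ : Pt ρ) : Prop :=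
  ∀ᶠ q in 𝓝 q₀, xJet r u q ∈ E.domain ∧ pdT u q = E.H (xJet r u q)

/-- The tuple `v` solves, near `q₀`, the system that consists of the evolution equation for
`ũ = v^0` and of the equations `v^{b-1} = ∂^{b-1}ũ/∂x̃^{b-1}`. -/
def SolvesInitialSystem [NeZero ρ] {r : ℕ} (E : EvolutionEquation r)
    (v : Pt ρ → (Fin ρ → ℝ)) (q₀ : Pt ρ) : Prop :=
  DerivativeEqs v q₀ ∧ SolvesEvolutionEq E (tildeU v) q₀

/-- The differential substitution `θ = -Ψ⁻¹ 𝓘_x` with `det Ψ ≠ 0`, near `p₀`. -/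
def DiffSubstitution (I θ : Pt ρ → (Fin ρ → ℝ)) (p₀ : Pt ρ) : Prop :=
  ∀ᶠ p in 𝓝 p₀, (jac I p).det ≠ 0 ∧ θ p = -((jac I p)⁻¹.mulVec (pdX I p))

/-- `(t, x, w) ↦ (t, x, F(t, x, w))`. -/
def hodographMap (F : Pt ρ → (Fin ρ → ℝ)) (p : Pt ρ) : Pt ρ := (p.1, p.2.1, F p)

/-- The hodograph transformation with the new independent variables `t̃ = t`, `x̃ = x`,
`ϰ_a = 𝓘^a` and the new dependent variables `v^{b-1} = u_{b-1}`: near `p₀` and its image,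
`(t, x, u) ↦ (t, x, 𝓘(t, x, u))` and `(t̃, x̃, ϰ) ↦ (t̃, x̃, v(t̃, x̃, ϰ))` are mutually inverse. -/
def Hodograph (I v : Pt ρ → (Fin ρ → ℝ)) (p₀ : Pt ρ) : Prop :=
  (∀ᶠ p in 𝓝 p₀, hodographMap v (hodographMap I p) = p) ∧
    ∀ᶠ q in 𝓝 (hodographMap I p₀), hodographMap I (hodographMap v q) = q

/-- Near `p₀` the tuples are related by `𝓘' = G(t, 𝓘)`, where `G` is smooth and invertible with
respect to its last argument. -/
def GaugeRelated (I I' : Pt ρ → (Fin ρ → ℝ)) (p₀ : Pt ρ) : Prop :=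
  ∃ G : ℝ × (Fin ρ → ℝ) → (Fin ρ → ℝ),
    SmoothNear G (p₀.1, I p₀) ∧
    (fderiv ℝ (fun k => G (p₀.1, k)) (I p₀)).det ≠ 0 ∧
    ∀ᶠ p in 𝓝 p₀, I' p = G (p.1, I p)

/-- Near `q₀` and `q₀'` the families `{u(·, ·, ϰ)}` and `{u'(·, ·, ϰ')}` differ only by an
invertible smooth change `ϰ' = ζ(ϰ)` of the parameters. -/
def Reparametrized (u u' : Pt ρ → ℝ) (q₀ q₀' : Pt ρ) : Prop :=
  ∃ ζ : (Fin ρ → ℝ) → (Fin ρ → ℝ),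
    SmoothNear ζ q₀.2.2 ∧ ζ q₀.2.2 = q₀'.2.2 ∧ (fderiv ℝ ζ q₀.2.2).det ≠ 0 ∧
    ∀ᶠ q in 𝓝 q₀, u' (q.1, q.2.1, ζ q.2.2) = u q

end Operators

/-!
In the new variables `(t̃, x̃, ϰ)` the differential substitution is the system `∂v/∂x̃ = θ(t̃, x̃, v)`
(`Hodograph.diffSubstitution_iff`, by differentiation of `𝓘(t̃, x̃, v) = ϰ`). So `v` is a family of
integral curves of the field `∂_x + ∑ θ^b ∂_{u_{b-1}}`, and `𝓘` is a full set of its first integrals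
independent of `t`. Such tuples exist by the smooth dependence of solutions of ordinary differential
equations on initial values and parameters (`SmoothNear.exists_family`), and two of them differ by a
map `G(t, ·)`, because the second one, written in the variables given by the first one, does not
depend on `x̃` (`DiffSubstitution.gaugeRelated`).

If in addition `θ^a = u_a` for `a < ρ`, then `v` consists of the derivatives of `ũ = v^0`, and along
`v` the operator `D̂_x` becomes `∂/∂x̃`, hence `û_k` becomes `∂^kũ/∂x̃^k` and `Ĥ` becomes the right
hand side of the evolution equation. If `ũ` solves this equation, then `∂v^b/∂t̃ = D̂_x^b Ĥ`, so that
`D̂_t` becomes `∂/∂t̃`, and the determining equation is `∂_t̃ ∂_x̃^ρ ũ = ∂_x̃^ρ ∂_t̃ ũ`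
(`SolvesJetODE.eventually_determiningEqAt`). Conversely, the determining equation implies that the
differences `w^b = ∂v^b/∂t̃ - D̂_x^b Ĥ` satisfy a homogeneous linear system of ordinary differential
equations in `x̃` (`SolvesJetODE.solvesTimeODE_of_initial`). They vanish if they vanish at `x̃ = x₀`,
and this is achieved if the initial values `v(t̃, x₀, ϰ)` are chosen as solutions of the system
`∂y^b/∂t̃ = (D̂_x^b Ĥ)(t̃, x₀, y)` (`SolvesDeterminingSystem.exists_family`). Finally, for two
solutions of the initial system with the same `θ` the derivatives `∂v/∂t̃` and `∂v'/∂t̃` are the same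
function of `(t, x, u)`. Thus `∂G/∂t = 0`, and `G` is a change of the parameters
(`reparametrized_of_solvesInitialSystem`).

The smoothness of the local flow of a vector field `g` is obtained from the inverse function theorem
in the Banach space of continuous functions on `[-1, 1]`: the rescaled problem
`α = z + ε ∫ g(α)` has, at `ε = 0`, the solution `α = z` and an invertible linearization, and the
superposition operator `α ↦ g ∘ α` is smooth (`exists_smoothNear_flow_of_contDiff`).
-/

/-! ### Functions that are smooth near a point -/

namespace SmoothNear

variable {X Y Z : Type*} [NormedAddCommGroup X] [NormedSpace ℝ X]
  [NormedAddCommGroup Y] [NormedSpace ℝ Y] [NormedAddCommGroup Z] [NormedSpace ℝ Z]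

theorem contDiffAt {f : X → Y} {p : X} (h : SmoothNear f p) : ContDiffAt ℝ ∞ f p :=
  h.self_of_nhds

theorem continuousAt {f : X → Y} {p : X} (h : SmoothNear f p) : ContinuousAt f p :=
  h.contDiffAt.continuousAt

theorem differentiableAt {f : X → Y} {p : X} (h : SmoothNear f p) : DifferentiableAt ℝ f p :=
  h.contDiffAt.differentiableAt (by simp)

theorem eventually {f : X → Y} {p : X} (h : SmoothNear f p) : ∀ᶠ q in 𝓝 p, SmoothNear f q :=
  eventually_eventually_nhds.2 h

theorem eventually_differentiableAt {f : X → Y} {p : X} (h : SmoothNear f p) :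
    ∀ᶠ q in 𝓝 p, DifferentiableAt ℝ f q :=
  h.eventually.mono fun _ hq => hq.differentiableAt

theorem comp {g : Y → Z} {f : X → Y} {p : X} (hg : SmoothNear g (f p)) (hf : SmoothNear f p) :
    SmoothNear (fun x => g (f x)) p := by
  filter_upwards [hf, hf.continuousAt.eventually hg] with x h1 h2
  exact h2.comp x h1

theorem comp_of_eq {g : Y → Z} {f : X → Y} {p : X} {y : Y} (hg : SmoothNear g y)
    (hf : SmoothNear f p) (hy : f p = y) : SmoothNear (fun x => g (f x)) p := by
  subst hy
  exact hg.comp hf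

theorem prodMk {f : X → Y} {g : X → Z} {p : X} (hf : SmoothNear f p) (hg : SmoothNear g p) :
    SmoothNear (fun x => (f x, g x)) p := by
  filter_upwards [hf, hg] with x h1 h2
  exact h1.prodMk h2

theorem fderiv_apply {f : X → Y} {p : X} (hf : SmoothNear f p) (w : X) :
    SmoothNear (fun x => fderiv ℝ f x w) p := by
  filter_upwards [hf] with x hx
  exact (hx.fderiv_right (m := ∞) (by simp)).clm_apply contDiffAt_const

theorem pi {ι : Type*} [Fintype ι] {f : X → ι → Y} {p : X}
    (h : ∀ i, SmoothNear (fun x => f x i) p) : SmoothNear f p := by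
  filter_upwards [eventually_all.2 h] with x hx
  exact contDiffAt_pi.2 hx

end SmoothNear

theorem ContDiff.smoothNear {X Y : Type*} [NormedAddCommGroup X] [NormedSpace ℝ X]
    [NormedAddCommGroup Y] [NormedSpace ℝ Y] {f : X → Y} (h : ContDiff ℝ ∞ f) (p : X) :
    SmoothNear f p :=
  Eventually.of_forall fun _ => h.contDiffAt

/-- Inverse function theorem: a map which is smooth near a point and whose derivative at this point
is invertible has a local inverse which is smooth near the image of the point. -/
theorem SmoothNear.exists_local_inverse {X Y : Type*} [NormedAddCommGroup X] [NormedSpace ℝ X]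
    [CompleteSpace X] [NormedAddCommGroup Y] [NormedSpace ℝ Y] {f : X → Y} {a : X}
    (hf : SmoothNear f a) {f' : X ≃L[ℝ] Y} (hf' : HasFDerivAt f (f' : X →L[ℝ] Y) a) :
    ∃ g : Y → X, SmoothNear g (f a) ∧ (∀ᶠ x in 𝓝 a, g (f x) = x) ∧
      ∀ᶠ y in 𝓝 (f a), f (g y) = y := by
  set e := hf.contDiffAt.toOpenPartialHomeomorph f hf' (by simp) with he
  have ha : a ∈ e.source := hf.contDiffAt.mem_toOpenPartialHomeomorph_source hf' (by simp)
  have hfa : f a ∈ e.target := e.map_source ha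
  have hsymm : e.symm (f a) = a := e.left_inv ha
  refine ⟨e.symm, ?_, e.eventually_left_inverse ha, e.eventually_right_inverse hfa⟩
  have hcont : ContinuousAt (fun x => fderiv ℝ f x) a :=
    (hf.contDiffAt.fderiv_right (m := ∞) (by simp)).continuousAt
  -- the derivative stays invertible near `a`, so the inverse is smooth near `f a` and not only
  -- at this point
  have hinv : ∀ᶠ x in 𝓝 a, fderiv ℝ f x ∈ Set.range ((↑) : (X ≃L[ℝ] Y) → X →L[ℝ] Y) :=
    hcont.eventually (by have := f'.nhds; rw [← hf'.fderiv] at this; exact this)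
  have key : ∀ᶠ y in 𝓝 (f a), y ∈ e.target ∧ ContDiffAt ℝ ∞ f (e.symm y) ∧
      fderiv ℝ f (e.symm y) ∈ Set.range ((↑) : (X ≃L[ℝ] Y) → X →L[ℝ] Y) := by
    have hc : Tendsto e.symm (𝓝 (f a)) (𝓝 a) := by
      have := e.continuousAt_symm hfa
      rwa [ContinuousAt, hsymm] at this
    filter_upwards [e.open_target.mem_nhds hfa, hc.eventually hf, hc.eventually hinv]
      with y h1 h2 h3 using ⟨h1, h2, h3⟩
  filter_upwards [key] with y ⟨hy, h1, ⟨g', hg'⟩⟩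
  refine e.contDiffAt_symm hy (f₀' := g') ?_ h1
  rw [hg']
  exact (h1.differentiableAt (by simp)).hasFDerivAt

/-! ### The superposition operator on continuous functions -/

section Nemytskii

variable {K : Type*} [TopologicalSpace K] [CompactSpace K]

universe u
variable {E F : Type u} [NormedAddCommGroup E] [NormedSpace ℝ E]
  [NormedAddCommGroup F] [NormedSpace ℝ F]

/-- Pointwise evaluation `(A, h) ↦ (s ↦ A s (h s))` of a continuous family of operators on a
continuous function, as a continuous bilinear map. -/
noncomputable def pointwiseApply (K : Type*) [TopologicalSpace K] [CompactSpace K]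
    (E F : Type u) [NormedAddCommGroup E] [NormedSpace ℝ E]
    [NormedAddCommGroup F] [NormedSpace ℝ F] :
    C(K, E →L[ℝ] F) →L[ℝ] C(K, E) →L[ℝ] C(K, F) :=
  LinearMap.mkContinuous₂
    (LinearMap.mk₂ ℝ
      (fun (A : C(K, E →L[ℝ] F)) (h : C(K, E)) =>
        (⟨fun s => A s (h s), A.continuous.clm_apply h.continuous⟩ : C(K, F)))
      (by intros; ext; simp) (by intros; ext; simp) (by intros; ext; simp) (by intros; ext; simp))
    1 (by
      intro A h
      rw [one_mul, ContinuousMap.norm_le _ (by positivity)]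
      intro s
      refine ((A s).le_opNorm (h s)).trans ?_
      gcongr
      · exact A.norm_coe_le_norm s
      · exact h.norm_coe_le_norm s)

/-- The superposition operator `α ↦ f ∘ α` is differentiable, with the derivative
`h ↦ (s ↦ f' (α s) (h s))`. -/
theorem hasFDerivAt_superposition {f : E → F} (hf : ContDiff ℝ 1 f) (α : C(K, E)) :
    HasFDerivAt (fun β : C(K, E) => (⟨f, hf.continuous⟩ : C(E, F)).comp β)
      (pointwiseApply K E F
        ((⟨fderiv ℝ f, hf.continuous_fderiv (by simp)⟩ : C(E, E →L[ℝ] F)).comp α)) α := by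
  set f₁ : C(E, E →L[ℝ] F) := ⟨fderiv ℝ f, hf.continuous_fderiv (by simp)⟩
  rw [hasFDerivAt_iff_isLittleO, Asymptotics.isLittleO_iff]
  intro c hc
  have hcont : Continuous fun β : C(K, E) => f₁.comp β := ContinuousMap.continuous_postcomp f₁
  obtain ⟨δ, hδ, hball⟩ :=
    (Metric.continuousAt_iff (α := C(K, E)) (β := C(K, E →L[ℝ] F))).1 (hcont.continuousAt (x := α)) c hc
  filter_upwards [Metric.ball_mem_nhds α hδ] with β hβ
  rw [ContinuousMap.norm_le _ (by positivity)]
  intro s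
  have hs : ‖β s - α s‖ ≤ ‖β - α‖ := (β - α).norm_coe_le_norm s
  have hβ' : ‖β - α‖ < δ := by rwa [← dist_eq_norm]
  have hmv := (convex_ball (α s) δ).norm_image_sub_le_of_norm_hasFDerivWithin_le'
    (f := f) (f' := fun y => fderiv ℝ f y) (φ := fderiv ℝ f (α s)) (C := c) (x := α s) (y := β s)
    (fun y _ => ((hf.differentiable (by simp)) y).hasFDerivAt.hasFDerivWithinAt) ?_
    (Metric.mem_ball_self hδ) (by rw [Metric.mem_ball, dist_eq_norm]; exact hs.trans_lt hβ')
  · calc _ = ‖f (β s) - f (α s) - (fderiv ℝ f (α s)) (β s - α s)‖ := rfl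
      _ ≤ c * ‖β s - α s‖ := hmv
      _ ≤ c * ‖β - α‖ := by gcongr
  · intro y hy
    -- the translate of `α` by the constant `y - α s` takes the value `y` at `s`
    have h1 : dist (α + ContinuousMap.const K (y - α s)) α < δ := by
      rw [dist_eq_norm, add_sub_cancel_left]
      refine lt_of_le_of_lt ?_ (by rwa [Metric.mem_ball, dist_eq_norm] at hy)
      exact (ContinuousMap.norm_le _ (norm_nonneg _)).2 fun _ => le_rfl
    have h2 := (ContinuousMap.dist_apply_le_dist s).trans (hball h1).le
    simpa [f₁, dist_eq_norm] using h2

theorem contDiff_superposition {f : E → F} (hf : ContDiff ℝ ∞ f) :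
    ContDiff ℝ ∞ (fun β : C(K, E) => (⟨f, hf.continuous⟩ : C(E, F)).comp β) := by
  rw [contDiff_infty]
  intro n
  induction n generalizing F with
  | zero =>
    exact contDiff_zero.2 (ContinuousMap.continuous_postcomp _)
  | succ n ih =>
    have hder := fun α : C(K, E) => hasFDerivAt_superposition (hf.of_le (by simp)) α
    push_cast
    rw [contDiff_succ_iff_fderiv]
    refine ⟨fun α => (hder α).differentiableAt, by simp, ?_⟩
    have heq : fderiv ℝ (fun β : C(K, E) => (⟨f, hf.continuous⟩ : C(E, F)).comp β) = fun α =>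
        pointwiseApply K E F ((⟨fderiv ℝ f, hf.continuous_fderiv (by simp)⟩ :
          C(E, E →L[ℝ] F)).comp α) := funext fun α => (hder α).fderiv
    rw [heq]
    exact (pointwiseApply K E F).contDiff.comp (ih (hf.fderiv_right (by simp)))

end Nemytskii

/-! ### The local flow of a smooth vector field -/

section Flow

universe u
variable {E : Type u} [NormedAddCommGroup E]

/-- The time interval `[-1, 1]` of the rescaled initial value problem. -/
abbrev TimeIcc : Type := Set.Icc (-1 : ℝ) 1

/-- The extension of a function on `[-1, 1]` to the line by constants. -/
noncomputable abbrev timeExtend (β : C(TimeIcc, E)) : ℝ → E :=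
  Set.IccExtend (by norm_num : (-1 : ℝ) ≤ 1) β

theorem continuous_timeExtend (β : C(TimeIcc, E)) : Continuous (timeExtend β) :=
  β.continuous.Icc_extend'

theorem timeExtend_coe (β : C(TimeIcc, E)) (s : TimeIcc) : timeExtend β s = β s :=
  Set.IccExtend_val _ _ s

theorem norm_timeExtend_le (β : C(TimeIcc, E)) (s : ℝ) : ‖timeExtend β s‖ ≤ ‖β‖ :=
  β.norm_coe_le_norm _

variable [NormedSpace ℝ E]

/-- The Volterra operator `β ↦ (s ↦ ∫₀ˢ β)` on continuous functions on `[-1, 1]`. -/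
noncomputable def volterra (E : Type u) [NormedAddCommGroup E] [NormedSpace ℝ E] :
    C(TimeIcc, E) →L[ℝ] C(TimeIcc, E) :=
  LinearMap.mkContinuous
    { toFun := fun β => ⟨fun s => ∫ τ in (0 : ℝ)..s, timeExtend β τ,
        (intervalIntegral.continuous_primitive
          (fun _ _ => (continuous_timeExtend β).intervalIntegrable _ _) 0).comp
          continuous_subtype_val⟩
      map_add' := by
        intro β γ
        ext s
        exact intervalIntegral.integral_add ((continuous_timeExtend β).intervalIntegrable _ _)
          ((continuous_timeExtend γ).intervalIntegrable _ _)
      map_smul' := by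
        intro c β
        ext s
        exact intervalIntegral.integral_smul c (timeExtend β) }
    1 (by
      intro β
      rw [one_mul, ContinuousMap.norm_le _ (by positivity)]
      intro s
      refine (intervalIntegral.norm_integral_le_of_norm_le_const
        fun τ _ => norm_timeExtend_le β τ).trans ?_
      have : |(s : ℝ) - 0| ≤ 1 := by rw [sub_zero, abs_le]; exact s.2
      exact mul_le_of_le_one_right (norm_nonneg _) this)

theorem volterra_apply (β : C(TimeIcc, E)) (s : TimeIcc) :
    volterra E β s = ∫ τ in (0 : ℝ)..s, timeExtend β τ := rfl

/-- Multiplication of the time by a number `c` with `|c| ≤ 1`. -/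
def timeScale (c : ℝ) (hc : |c| ≤ 1) : C(TimeIcc, TimeIcc) where
  toFun s := ⟨c * s, abs_le.1 (by
    rw [abs_mul]; exact mul_le_one₀ hc (abs_nonneg _) (abs_le.2 s.2))⟩
  continuous_toFun := by fun_prop

/-- The Volterra operator and the change of the time scale. -/
theorem smul_volterra_comp_timeScale (β : C(TimeIcc, E)) (c : ℝ) (hc : |c| ≤ 1) :
    c • volterra E (β.comp (timeScale c hc)) = (volterra E β).comp (timeScale c hc) := by
  ext s
  have hs := s.2
  have h1 : ∫ τ in (0 : ℝ)..s, timeExtend (β.comp (timeScale c hc)) τ =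
      ∫ τ in (0 : ℝ)..s, timeExtend β (c * τ) := by
    refine intervalIntegral.integral_congr fun τ hτ => ?_
    have hτ' : τ ∈ Set.Icc (-1 : ℝ) 1 :=
      Set.uIcc_subset_Icc (by norm_num) hs hτ
    have e1 := timeExtend_coe (β.comp (timeScale c hc)) ⟨τ, hτ'⟩
    have e2 := timeExtend_coe β (timeScale c hc ⟨τ, hτ'⟩)
    exact e1.trans e2.symm
  have h2 := intervalIntegral.smul_integral_comp_mul_left (a := 0) (b := (s : ℝ)) (timeExtend β) c
  rw [mul_zero] at h2
  rw [ContinuousMap.smul_apply, volterra_apply, h1, h2]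
  rfl

variable [CompleteSpace E]

/-- The local flow of a smooth vector field on a Banach space, as a smooth function of the time and
the initial value. The rescaled problem `α' = ε g(α)`, `α(0) = z` on `[-1, 1]` is solved near
`ε = 0` by the inverse function theorem in the space of continuous functions, and the flow is
`α(1)`. -/
theorem exists_smoothNear_flow_of_contDiff {g : E → E} (hg : ContDiff ℝ ∞ g) (z₀ : E) :
    ∃ φ : ℝ × E → E, SmoothNear φ (0, z₀) ∧ (∀ᶠ z in 𝓝 z₀, φ (0, z) = z) ∧
      ∀ᶠ p in 𝓝 ((0 : ℝ), z₀), HasDerivAt (fun s => φ (s, p.2)) (g (φ p)) p.1 := by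
  let N : C(TimeIcc, E) → C(TimeIcc, E) := fun α => (⟨g, hg.continuous⟩ : C(E, E)).comp α
  have hN : ContDiff ℝ ∞ N := contDiff_superposition hg
  let C : E →L[ℝ] C(TimeIcc, E) := ContinuousLinearMap.const ℝ TimeIcc
  let Φ : (ℝ × E) × C(TimeIcc, E) → (ℝ × E) × C(TimeIcc, E) := fun p =>
    (p.1, p.2 - C p.1.2 - p.1.1 • volterra E (N p.2))
  have hΦ : ContDiff ℝ ∞ Φ := by
    have h1 : ContDiff ℝ ∞ fun p : (ℝ × E) × C(TimeIcc, E) => volterra E (N p.2) :=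
      (volterra E).contDiff.comp (hN.comp contDiff_snd)
    exact contDiff_fst.prodMk ((contDiff_snd.sub (C.contDiff.comp
      (contDiff_snd.comp contDiff_fst))).sub ((contDiff_fst.comp contDiff_fst).smul h1))
  let a : (ℝ × E) × C(TimeIcc, E) := ((0, z₀), C z₀)
  -- at `ε = 0` the linearization of `Φ` is a shear, with the lower left block `Λ`
  let Λ : (ℝ × E) →L[ℝ] C(TimeIcc, E) :=
    -(C.comp (ContinuousLinearMap.snd ℝ ℝ E)) -
      (ContinuousLinearMap.fst ℝ ℝ E).smulRight (volterra E (N (C z₀)))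
  have hder : HasFDerivAt Φ (((ContinuousLinearEquiv.refl ℝ (ℝ × E)).skewProd
      (ContinuousLinearEquiv.refl ℝ C(TimeIcc, E)) Λ :
        ((ℝ × E) × C(TimeIcc, E)) ≃L[ℝ] ((ℝ × E) × C(TimeIcc, E))) :
      ((ℝ × E) × C(TimeIcc, E)) →L[ℝ] ((ℝ × E) × C(TimeIcc, E))) a := by
    have h1 : DifferentiableAt ℝ (fun p : (ℝ × E) × C(TimeIcc, E) => volterra E (N p.2)) a :=
      ((volterra E).contDiff.comp (hN.comp contDiff_snd)).differentiable (by simp) a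
    have h2 := (((ContinuousLinearMap.fst ℝ ℝ E).comp
      (ContinuousLinearMap.fst ℝ (ℝ × E) C(TimeIcc, E))).hasFDerivAt (x := a)).smul h1.hasFDerivAt
    have h3 := ((ContinuousLinearMap.snd ℝ (ℝ × E) C(TimeIcc, E)).hasFDerivAt (x := a)).sub
      ((C.comp ((ContinuousLinearMap.snd ℝ ℝ E).comp
        (ContinuousLinearMap.fst ℝ (ℝ × E) C(TimeIcc, E)))).hasFDerivAt (x := a))
    have h4 := (ContinuousLinearMap.fst ℝ (ℝ × E) C(TimeIcc, E)).hasFDerivAt (x := a)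
    refine (h4.prodMk (h3.sub h2)).congr_fderiv ?_
    refine ContinuousLinearMap.ext fun w => Prod.ext rfl ?_
    simp [Λ, a]
    abel
  have hΦa : Φ a = ((0, z₀), 0) := by simp [Φ, a]
  obtain ⟨G, hG, hleft, hright⟩ := (hΦ.smoothNear a).exists_local_inverse hder
  rw [hΦa] at hG hright
  let A : ℝ × E → C(TimeIcc, E) := fun q => (G (q, 0)).2
  have hA : SmoothNear A (0, z₀) := by
    have h0 : SmoothNear (fun q : ℝ × E => (q, (0 : C(TimeIcc, E)))) (0, z₀) :=
      (contDiff_id.prodMk contDiff_const).smoothNear _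
    exact (contDiff_snd.smoothNear _).comp (hG.comp_of_eq h0 rfl)
  have hA0 : A (0, z₀) = C z₀ := by
    have := hleft.self_of_nhds
    rw [hΦa] at this
    exact congrArg Prod.snd this
  -- the integral equation
  have hint : ∀ᶠ q in 𝓝 ((0 : ℝ), z₀), A q = C q.2 + q.1 • volterra E (N (A q)) := by
    have hc : ContinuousAt (fun q : ℝ × E => (q, (0 : C(TimeIcc, E)))) (0, z₀) := by fun_prop
    filter_upwards [hc.eventually hright] with q hq
    have h1 : (G (q, 0)).1 = q := congrArg Prod.fst hq
    have h2 : (G (q, 0)).2 - C (G (q, 0)).1.2 - (G (q, 0)).1.1 • volterra E (N (G (q, 0)).2) = 0 :=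
      congrArg Prod.snd hq
    rw [h1, sub_sub, sub_eq_zero] at h2
    exact h2
  obtain ⟨δ₁, hδ₁, hleft'⟩ := Metric.eventually_nhds_iff_ball.1 hleft
  have hnear : ∀ᶠ q in 𝓝 ((0 : ℝ), z₀), dist (A q) (C z₀) < δ₁ := by
    have := hA.continuousAt.eventually (Metric.ball_mem_nhds _ hδ₁)
    rw [hA0] at this
    exact this
  obtain ⟨δ, hδ, hball⟩ := Metric.eventually_nhds_iff_ball.1 (hint.and hnear)
  -- `s ↦ A (ε, z) (c * s)` solves the integral equation with `c * ε` in place of `ε`, and the local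
  -- injectivity of `Φ` identifies it with `A (c * ε, z)`
  have hscale : ∀ (c ε : ℝ) (z : E) (hc : |c| ≤ 1), |ε| < min δ δ₁ → dist z z₀ < min δ δ₁ →
      A (c * ε, z) = (A (ε, z)).comp (timeScale c hc) := by
    intro c ε z hc hε hz
    have hmem : (ε, z) ∈ Metric.ball ((0 : ℝ), z₀) δ := by
      rw [Metric.mem_ball, Prod.dist_eq, max_lt_iff, Real.dist_eq, sub_zero]
      exact ⟨hε.trans_le (min_le_left _ _), hz.trans_le (min_le_left _ _)⟩
    obtain ⟨he, hd⟩ := hball _ hmem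
    have hcε : |c * ε| < δ₁ := by
      rw [abs_mul]
      exact (mul_le_of_le_one_left (abs_nonneg _) hc).trans_lt (hε.trans_le (min_le_right _ _))
    have hd' : dist ((A (ε, z)).comp (timeScale c hc)) (C z₀) < δ₁ := by
      refine lt_of_le_of_lt ?_ hd
      exact (ContinuousMap.dist_le dist_nonneg).2 fun s =>
        ContinuousMap.dist_apply_le_dist (f := A (ε, z)) (g := C z₀) (timeScale c hc s)
    have hmem' : ((c * ε, z), (A (ε, z)).comp (timeScale c hc)) ∈ Metric.ball a δ₁ := by
      rw [Metric.mem_ball, Prod.dist_eq, Prod.dist_eq, max_lt_iff, max_lt_iff, Real.dist_eq,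
        sub_zero]
      exact ⟨⟨hcε, hz.trans_le (min_le_right _ _)⟩, hd'⟩
    have hΦ0 : Φ ((c * ε, z), (A (ε, z)).comp (timeScale c hc)) = ((c * ε, z), 0) := by
      refine Prod.ext rfl ?_
      change (A (ε, z)).comp (timeScale c hc) - C z - (c * ε) • volterra E
        ((N (A (ε, z))).comp (timeScale c hc)) = 0
      rw [mul_comm, mul_smul, smul_volterra_comp_timeScale, sub_sub, sub_eq_zero]
      ext s
      exact congrArg (fun β : C(TimeIcc, E) => β (timeScale c hc s)) he
    have := hleft' _ hmem'
    rw [hΦ0] at this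
    exact congrArg Prod.snd this
  have hpos : 0 < min δ δ₁ := lt_min hδ hδ₁
  set ε₁ := min δ δ₁ / 2 with hε₁
  have hε₁pos : 0 < ε₁ := by positivity
  have hε₁lt : |ε₁| < min δ δ₁ := by rw [abs_of_pos hε₁pos]; linarith
  -- so for `|s| ≤ ε₁` the values `A (s, z) 1` run along the single solution `A (ε₁, z)`
  let one : TimeIcc := ⟨1, by norm_num⟩
  have hφ : ∀ (s : ℝ) (z : E), |s| ≤ ε₁ → dist z z₀ < min δ δ₁ →
      A (s, z) one = z + ε₁ • ∫ τ in (0 : ℝ)..(s / ε₁), g (timeExtend (A (ε₁, z)) τ) := by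
    intro s z hs hz
    have hc : |s / ε₁| ≤ 1 := by
      rw [abs_div, abs_of_pos hε₁pos]
      exact (div_le_one hε₁pos).2 hs
    have h1 := hscale (s / ε₁) ε₁ z hc hε₁lt hz
    rw [div_mul_cancel₀ _ hε₁pos.ne'] at h1
    have hmem : (ε₁, z) ∈ Metric.ball ((0 : ℝ), z₀) δ := by
      rw [Metric.mem_ball, Prod.dist_eq, max_lt_iff, Real.dist_eq, sub_zero]
      exact ⟨hε₁lt.trans_le (min_le_left _ _), hz.trans_le (min_le_left _ _)⟩
    have h2 := congrArg (fun β : C(TimeIcc, E) => β (timeScale (s / ε₁) hc one)) (hball _ hmem).1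
    have h3 : ((timeScale (s / ε₁) hc one : TimeIcc) : ℝ) = s / ε₁ := mul_one _
    rw [h1]
    refine h2.trans ?_
    rw [ContinuousMap.add_apply, ContinuousMap.smul_apply, volterra_apply, h3]
    rfl
  have hφ' : ∀ (s : ℝ) (z : E), |s| ≤ ε₁ → dist z z₀ < min δ δ₁ →
      A (s, z) one = timeExtend (A (ε₁, z)) (s / ε₁) := by
    intro s z hs hz
    have hc : |s / ε₁| ≤ 1 := by
      rw [abs_div, abs_of_pos hε₁pos]
      exact (div_le_one hε₁pos).2 hs
    have h1 := hscale (s / ε₁) ε₁ z hc hε₁lt hz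
    rw [div_mul_cancel₀ _ hε₁pos.ne'] at h1
    have h3 : ((timeScale (s / ε₁) hc one : TimeIcc) : ℝ) = s / ε₁ := mul_one _
    have h4 := timeExtend_coe (A (ε₁, z)) (timeScale (s / ε₁) hc one)
    rw [h3] at h4
    rw [h1, h4]
    rfl
  have hz_near : ∀ᶠ z in 𝓝 z₀, dist z z₀ < min δ δ₁ := Metric.ball_mem_nhds _ hpos
  refine ⟨fun q => A q one, ?_, ?_, ?_⟩
  · filter_upwards [hA] with q hq
    exact (ContinuousMap.evalCLM ℝ one).contDiff.contDiffAt.comp q hq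
  · filter_upwards [hz_near] with z hz
    rw [hφ 0 z (by simpa using hε₁pos.le) hz]
    simp
  · have h1 : ∀ᶠ s in 𝓝 (0 : ℝ), |s| < ε₁ := by
      have := Metric.ball_mem_nhds (0 : ℝ) hε₁pos
      filter_upwards [this] with s hs
      simpa using hs
    have h2 : ∀ᶠ p in 𝓝 ((0 : ℝ), z₀), |p.1| < ε₁ ∧ dist p.2 z₀ < min δ δ₁ := by
      rw [nhds_prod_eq]
      exact h1.prod_mk hz_near
    filter_upwards [h2] with p ⟨hp, hz⟩
    change HasDerivAt (fun s => A (s, p.2) one) (g (A (p.1, p.2) one)) p.1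
    have hcont : Continuous fun τ => g (timeExtend (A (ε₁, p.2)) τ) :=
      hg.continuous.comp (continuous_timeExtend _)
    have h3 := (hcont.integral_hasStrictDerivAt 0 (p.1 / ε₁)).hasDerivAt
    have h4 := ((h3.scomp p.1 ((hasDerivAt_id p.1).div_const ε₁)).const_smul ε₁).const_add p.2
    rw [hφ' p.1 p.2 hp.le hz]
    have h5 : ∀ᶠ s in 𝓝 p.1, |s| < ε₁ :=
      (continuous_abs.continuousAt (x := p.1)).eventually (gt_mem_nhds hp)
    refine HasDerivAt.congr_of_eventuallyEq (h4.congr_deriv ?_) ?_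
    · rw [smul_smul, mul_one_div_cancel hε₁pos.ne', one_smul]
    · filter_upwards [h5] with s hs
      exact hφ s p.2 hs.le hz

end Flow

/-- A function which is smooth near a point coincides near this point with a function which is
smooth everywhere. -/
theorem SmoothNear.exists_contDiff_eventuallyEq {E F : Type*} [NormedAddCommGroup E]
    [NormedSpace ℝ E] [FiniteDimensional ℝ E] [NormedAddCommGroup F] [NormedSpace ℝ F]
    {f : E → F} {z : E} (hf : SmoothNear f z) :
    ∃ g : E → F, ContDiff ℝ ∞ g ∧ g =ᶠ[𝓝 z] f := by
  obtain ⟨δ, hδ, hball⟩ := Metric.eventually_nhds_iff_ball.1 hf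
  let χ : ContDiffBump z := ⟨δ / 4, δ / 2, by positivity, by linarith⟩
  refine ⟨fun x => χ x • f x, contDiff_iff_contDiffAt.2 fun x => ?_, ?_⟩
  · by_cases hx : x ∈ tsupport χ
    · rw [χ.tsupport_eq, Metric.mem_closedBall] at hx
      have hx' : x ∈ Metric.ball z δ := by
        rw [Metric.mem_ball]
        exact hx.trans_lt (by change δ / 2 < δ; linarith)
      exact χ.contDiffAt.smul (hball x hx')
    · have h0 : (fun y => χ y • f y) =ᶠ[𝓝 x] fun _ => 0 := by
        filter_upwards [notMem_tsupport_iff_eventuallyEq.1 hx] with y hy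
        rw [hy, Pi.zero_apply, zero_smul]
      exact contDiffAt_const.congr_of_eventuallyEq h0
  · filter_upwards [χ.eventuallyEq_one] with x hx
    rw [hx, Pi.one_apply, one_smul]

/-- The local flow of a vector field which is smooth near a point. -/
theorem SmoothNear.exists_flow {E : Type*} [NormedAddCommGroup E] [NormedSpace ℝ E]
    [FiniteDimensional ℝ E] {f : E → E} {z₀ : E} (hf : SmoothNear f z₀) :
    ∃ φ : ℝ × E → E, SmoothNear φ (0, z₀) ∧ (∀ᶠ z in 𝓝 z₀, φ (0, z) = z) ∧
      ∀ᶠ p in 𝓝 ((0 : ℝ), z₀), HasDerivAt (fun s => φ (s, p.2)) (f (φ p)) p.1 := by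
  have : CompleteSpace E := FiniteDimensional.complete ℝ E
  obtain ⟨g, hg, hgf⟩ := hf.exists_contDiff_eventuallyEq
  obtain ⟨φ, hφ, h0, hd⟩ := exists_smoothNear_flow_of_contDiff hg z₀
  refine ⟨φ, hφ, h0, ?_⟩
  have hc := hφ.continuousAt
  rw [ContinuousAt, h0.self_of_nhds] at hc
  filter_upwards [hd, hc.eventually hgf] with p h1 h2
  rw [← h2]
  exact h1

/-- A solution of a differential inequality `‖∂_e w‖ ≤ K ‖w‖` in a ball vanishes at each point of
the ball that can be joined within the ball, in the direction `e`, with a zero of `w`. -/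
theorem exists_ball_eq_zero_of_norm_fderiv_le {X Y : Type*} [NormedAddCommGroup X]
    [NormedSpace ℝ X] [NormedAddCommGroup Y] [NormedSpace ℝ Y] {w : X → Y} {q₀ e : X} {K : ℝ}
    (hw : ∀ᶠ q in 𝓝 q₀, DifferentiableAt ℝ w q ∧ ‖fderiv ℝ w q e‖ ≤ K * ‖w q‖) :
    ∃ δ > 0, ∀ q ∈ Metric.ball q₀ δ, ∀ s : ℝ, q + s • e ∈ Metric.ball q₀ δ →
      w (q + s • e) = 0 → w q = 0 := by
  obtain ⟨δ, hδ, hball⟩ := Metric.eventually_nhds_iff_ball.1 hw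
  refine ⟨δ, hδ, fun q hq s hs h0 => ?_⟩
  let γ : ℝ → X := fun σ => (q + s • e) + σ • (-(s • e))
  have hγ : ∀ σ, HasDerivAt γ (-(s • e)) σ := fun σ => by
    exact (((hasDerivAt_id σ).smul_const (-(s • e))).const_add (q + s • e)).congr_deriv
      (one_smul ℝ _)
  have hmem : ∀ σ ∈ Set.Icc (0 : ℝ) 1, γ σ ∈ Metric.ball q₀ δ := by
    intro σ hσ
    have hconv := (convex_ball q₀ δ) hs hq (a := 1 - σ) (b := σ) (by linarith [hσ.2]) hσ.1
      (by ring)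
    convert hconv using 1
    simp only [γ]
    module
  have hder : ∀ σ ∈ Set.Icc (0 : ℝ) 1,
      HasDerivAt (fun σ => w (γ σ)) (fderiv ℝ w (γ σ) (-(s • e))) σ := fun σ hσ =>
    (hball _ (hmem σ hσ)).1.hasFDerivAt.comp_hasDerivAt σ (hγ σ)
  have key := eq_zero_of_abs_deriv_le_mul_abs_self_of_eq_zero_right
    (f := fun σ => w (γ σ)) (f' := fun σ => fderiv ℝ w (γ σ) (-(s • e))) (K := |s| * K)
    (a := 0) (b := 1)
    (fun σ hσ => (hder σ hσ).continuousAt.continuousWithinAt)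
    (fun σ hσ => (hder σ ⟨hσ.1, hσ.2.le⟩).hasDerivWithinAt) (by simpa [γ] using h0)
    (fun σ hσ => by
      rw [map_neg, map_smul, norm_neg, norm_smul, Real.norm_eq_abs, mul_assoc]
      exact mul_le_mul_of_nonneg_left (hball _ (hmem σ ⟨hσ.1, hσ.2.le⟩)).2 (abs_nonneg s))
    1 (by simp)
  simpa [γ] using key

/-! ### Partial derivatives and the hodograph map -/

section PointCalculus

variable {ρ : ℕ} {Y : Type*} [NormedAddCommGroup Y] [NormedSpace ℝ Y]

/-- The derivative of a function in terms of its partial derivatives. -/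
theorem fderiv_apply_eq_partials (f : Pt ρ → Y) (p : Pt ρ) (w : Pt ρ) :
    fderiv ℝ f p w = w.1 • pdT f p + w.2.1 • pdX f p + ∑ b, w.2.2 b • pdU b f p := by
  have h1 : (0, 0, w.2.2) = ∑ b, w.2.2 b • ((0, 0, Pi.single b 1) : Pt ρ) := by
    refine Prod.ext ?_ (Prod.ext ?_ ?_)
    · simp [Prod.fst_sum]
    · simp [Prod.fst_sum, Prod.snd_sum]
    · simp only [Prod.snd_sum, Prod.smul_snd]
      exact pi_eq_sum_univ' w.2.2
  have h2 : w = w.1 • ((1, 0, 0) : Pt ρ) + w.2.1 • ((0, 1, 0) : Pt ρ) + (0, 0, w.2.2) := by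
    ext <;> simp
  conv_lhs => rw [h2, h1]
  simp only [map_add, map_smul, map_sum, pdT, pdX, pdU]

theorem sum_smul_pdU_eq_jac_mulVec (F : Pt ρ → (Fin ρ → ℝ)) (p : Pt ρ) (c : Fin ρ → ℝ) :
    ∑ b, c b • pdU b F p = (jac F p).mulVec c := by
  ext a
  simp [Matrix.mulVec, dotProduct, jac, mul_comm]

theorem pdT_apply {F : Pt ρ → (Fin ρ → ℝ)} {p : Pt ρ} (hF : DifferentiableAt ℝ F p) (b : Fin ρ) :
    pdT (fun q => F q b) p = pdT F p b := by
  rw [pdT, fderiv_apply hF b]; rfl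

theorem pdX_apply {F : Pt ρ → (Fin ρ → ℝ)} {p : Pt ρ} (hF : DifferentiableAt ℝ F p) (b : Fin ρ) :
    pdX (fun q => F q b) p = pdX F p b := by
  rw [pdX, fderiv_apply hF b]; rfl

protected theorem SmoothNear.pdT {f : Pt ρ → Y} {p : Pt ρ} (hf : SmoothNear f p) :
    SmoothNear (pdT f) p := hf.fderiv_apply _

protected theorem SmoothNear.pdX {f : Pt ρ → Y} {p : Pt ρ} (hf : SmoothNear f p) :
    SmoothNear (pdX f) p := hf.fderiv_apply _

protected theorem SmoothNear.pdU {f : Pt ρ → Y} {p : Pt ρ} (hf : SmoothNear f p) (b : Fin ρ) :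
    SmoothNear (pdU b f) p := hf.fderiv_apply _

theorem SmoothNear.component {F : Pt ρ → (Fin ρ → ℝ)} {p : Pt ρ} (hF : SmoothNear F p)
    (b : Fin ρ) : SmoothNear (fun q => F q b) p :=
  ((contDiff_apply ℝ ℝ b).smoothNear _).comp hF

protected theorem SmoothNear.hodographMap {F : Pt ρ → (Fin ρ → ℝ)} {p : Pt ρ}
    (hF : SmoothNear F p) : SmoothNear (hodographMap F) p :=
  (contDiff_fst.smoothNear _).prodMk (((contDiff_fst.comp contDiff_snd).smoothNear _).prodMk hF)

theorem hasFDerivAt_hodographMap {F : Pt ρ → (Fin ρ → ℝ)} {p : Pt ρ}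
    (hF : DifferentiableAt ℝ F p) :
    HasFDerivAt (hodographMap F) ((ContinuousLinearMap.fst ℝ ℝ (ℝ × (Fin ρ → ℝ))).prod
      (((ContinuousLinearMap.fst ℝ ℝ (Fin ρ → ℝ)).comp
        (ContinuousLinearMap.snd ℝ ℝ (ℝ × (Fin ρ → ℝ)))).prod (fderiv ℝ F p))) p :=
  hasFDerivAt_fst.prodMk
    ((hasFDerivAt_fst.comp p hasFDerivAt_snd).prodMk hF.hasFDerivAt)

theorem fderiv_comp_hodographMap {f : Pt ρ → Y} {F : Pt ρ → (Fin ρ → ℝ)} {q : Pt ρ}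
    (hf : DifferentiableAt ℝ f (hodographMap F q)) (hF : DifferentiableAt ℝ F q) (w : Pt ρ) :
    fderiv ℝ (fun q => f (hodographMap F q)) q w =
      fderiv ℝ f (hodographMap F q) (w.1, w.2.1, fderiv ℝ F q w) := by
  exact congrArg (fun L : Pt ρ →L[ℝ] Y => L w)
    (hf.hasFDerivAt.comp q (hasFDerivAt_hodographMap hF)).fderiv

theorem pdT_comp_hodographMap {f : Pt ρ → Y} {F : Pt ρ → (Fin ρ → ℝ)} {q : Pt ρ}
    (hf : DifferentiableAt ℝ f (hodographMap F q)) (hF : DifferentiableAt ℝ F q) :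
    pdT (fun q => f (hodographMap F q)) q =
      pdT f (hodographMap F q) + ∑ b, pdT F q b • pdU b f (hodographMap F q) := by
  rw [pdT, fderiv_comp_hodographMap hf hF, fderiv_apply_eq_partials]
  simp [pdT]

theorem pdX_comp_hodographMap {f : Pt ρ → Y} {F : Pt ρ → (Fin ρ → ℝ)} {q : Pt ρ}
    (hf : DifferentiableAt ℝ f (hodographMap F q)) (hF : DifferentiableAt ℝ F q) :
    pdX (fun q => f (hodographMap F q)) q =
      pdX f (hodographMap F q) + ∑ b, pdX F q b • pdU b f (hodographMap F q) := by
  rw [pdX, fderiv_comp_hodographMap hf hF, fderiv_apply_eq_partials]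
  simp [pdX]

theorem jac_comp_hodographMap {I F : Pt ρ → (Fin ρ → ℝ)} {q : Pt ρ}
    (hI : DifferentiableAt ℝ I (hodographMap F q)) (hF : DifferentiableAt ℝ F q) :
    jac (fun q => I (hodographMap F q)) q = jac I (hodographMap F q) * jac F q := by
  ext a c
  simp only [jac, Matrix.of_apply, Matrix.mul_apply]
  rw [pdU, fderiv_comp_hodographMap hI hF, fderiv_apply_eq_partials]
  simp [pdU, mul_comm]

/-- Partial derivatives with respect to `t` and `x` commute. -/
theorem pdT_pdX {f : Pt ρ → Y} {p : Pt ρ} (hf : SmoothNear f p) :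
    pdT (pdX f) p = pdX (pdT f) p := by
  have hd : DifferentiableAt ℝ (fderiv ℝ f) p :=
    (hf.contDiffAt.fderiv_right (m := ∞) (by simp)).differentiableAt (by simp)
  have hs : IsSymmSndFDerivAt ℝ f p := hf.contDiffAt.isSymmSndFDerivAt (by
    rw [minSmoothness_of_isRCLikeNormedField]
    exact WithTop.coe_le_coe.2 le_top)
  have h (w w' : Pt ρ) : fderiv ℝ (fun q => fderiv ℝ f q w) p w' =
      fderiv ℝ (fderiv ℝ f) p w' w := by
    rw [fderiv_clm_apply hd (differentiableAt_const w)]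
    simp
  change fderiv ℝ (fun q => fderiv ℝ f q _) p _ = fderiv ℝ (fun q => fderiv ℝ f q _) p _
  rw [h, h]
  exact hs _ _

end PointCalculus

/-! ### The hodograph transformation -/

section HodographCalculus

variable {ρ : ℕ} {Y : Type*} [NormedAddCommGroup Y] [NormedSpace ℝ Y]

theorem fderiv_vertical_eq_jac_mulVec (F : Pt ρ → (Fin ρ → ℝ)) (p : Pt ρ) (c : Fin ρ → ℝ) :
    fderiv ℝ F p (0, 0, c) = (jac F p).mulVec c := by
  rw [fderiv_apply_eq_partials, ← sum_smul_pdU_eq_jac_mulVec]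
  simp

/-- The determinant of the derivative with respect to the last argument is the determinant of the
Jacobian matrix. -/
theorem det_fderiv_last_eq_det_jac {F : Pt ρ → (Fin ρ → ℝ)} {p : Pt ρ}
    (hF : DifferentiableAt ℝ F p) :
    (fderiv ℝ (fun k => F (p.1, p.2.1, k)) p.2.2).det = (jac F p).det := by
  have h1 : HasFDerivAt (fun k : Fin ρ → ℝ => ((p.1, p.2.1, k) : Pt ρ))
      ((0 : (Fin ρ → ℝ) →L[ℝ] ℝ).prod ((0 : (Fin ρ → ℝ) →L[ℝ] ℝ).prod
        (ContinuousLinearMap.id ℝ (Fin ρ → ℝ)))) p.2.2 :=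
    (hasFDerivAt_const _ _).prodMk ((hasFDerivAt_const _ _).prodMk (hasFDerivAt_id _))
  have h2 := (HasFDerivAt.comp (g := F) p.2.2 hF.hasFDerivAt h1).fderiv
  change (fderiv ℝ (F ∘ fun k : Fin ρ → ℝ => ((p.1, p.2.1, k) : Pt ρ)) p.2.2).det = _
  rw [h2, ContinuousLinearMap.det, ← LinearMap.det_toLin']
  congr 1
  refine LinearMap.ext fun c => ?_
  rw [Matrix.toLin'_apply, ← fderiv_vertical_eq_jac_mulVec]
  rfl

theorem SmoothNear.continuousAt_det_jac {F : Pt ρ → (Fin ρ → ℝ)} {p : Pt ρ}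
    (hF : SmoothNear F p) : ContinuousAt (fun q => (jac F q).det) p := by
  have h : ContinuousAt (jac F) p :=
    continuousAt_pi.2 fun a => continuousAt_pi.2 fun b =>
      ((hF.pdU b).component a).continuousAt
  exact (Continuous.matrix_det continuous_id).continuousAt.comp h

theorem SmoothNear.eventually_det_jac_ne_zero {F : Pt ρ → (Fin ρ → ℝ)} {p : Pt ρ}
    (hF : SmoothNear F p) (h : (jac F p).det ≠ 0) : ∀ᶠ q in 𝓝 p, (jac F q).det ≠ 0 :=
  hF.continuousAt_det_jac.eventually_ne h

/-- The hodograph transformation: `(t, x, w) ↦ (t, x, F(t, x, w))` has a local inverse of the same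
form if the Jacobian matrix of `F` with respect to `w` is invertible. -/
theorem SmoothNear.exists_hodograph {F : Pt ρ → (Fin ρ → ℝ)} {p : Pt ρ} (hF : SmoothNear F p)
    (hdet : (jac F p).det ≠ 0) :
    ∃ G : Pt ρ → (Fin ρ → ℝ), SmoothNear G (hodographMap F p) ∧ Hodograph F G p := by
  have hd := hasFDerivAt_hodographMap hF.differentiableAt
  set L := (ContinuousLinearMap.fst ℝ ℝ (ℝ × (Fin ρ → ℝ))).prod
      (((ContinuousLinearMap.fst ℝ ℝ (Fin ρ → ℝ)).comp
        (ContinuousLinearMap.snd ℝ ℝ (ℝ × (Fin ρ → ℝ)))).prod (fderiv ℝ F p)) with hL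
  have hinj : Function.Injective (L : Pt ρ →ₗ[ℝ] Pt ρ) := by
    rw [← LinearMap.ker_eq_bot, LinearMap.ker_eq_bot']
    rintro ⟨a, b, c⟩ h
    have ha : a = 0 := congrArg Prod.fst h
    have hb : b = 0 := congrArg (fun z => z.2.1) h
    have hc : fderiv ℝ F p (a, b, c) = 0 := congrArg (fun z => z.2.2) h
    rw [ha, hb, fderiv_vertical_eq_jac_mulVec] at hc
    rw [ha, hb, Matrix.eq_zero_of_mulVec_eq_zero hdet hc]
    rfl
  -- in finite dimension the injective endomorphism `L` is invertible
  let L' : Pt ρ ≃L[ℝ] Pt ρ :=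
    (LinearEquiv.ofInjectiveEndo (L : Pt ρ →ₗ[ℝ] Pt ρ) hinj).toContinuousLinearEquiv
  have hd' : HasFDerivAt (hodographMap F) (L' : Pt ρ →L[ℝ] Pt ρ) p :=
    hd.congr_fderiv (ContinuousLinearMap.ext fun _ => rfl)
  obtain ⟨g, hg, hleft, hright⟩ := hF.hodographMap.exists_local_inverse hd'
  have hform : ∀ᶠ q in 𝓝 (hodographMap F p), hodographMap (fun q => (g q).2.2) q = g q := by
    filter_upwards [hright] with q hq
    have h1 : (hodographMap F (g q)).1 = q.1 := congrArg Prod.fst hq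
    have h2 : (hodographMap F (g q)).2.1 = q.2.1 := congrArg (fun z => z.2.1) hq
    change (g q).1 = q.1 at h1
    change (g q).2.1 = q.2.1 at h2
    rw [hodographMap, ← h1, ← h2]
  refine ⟨fun q => (g q).2.2,
    ((contDiff_snd.comp contDiff_snd).smoothNear (g (hodographMap F p))).comp hg, ?_, ?_⟩
  · filter_upwards [hleft, hF.hodographMap.continuousAt.eventually hform] with q h1 h2
    rw [h2, h1]
  · filter_upwards [hright, hform] with q h1 h2
    rw [h2, h1]

namespace Hodograph

variable {I v : Pt ρ → (Fin ρ → ℝ)} {p₀ : Pt ρ}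

theorem apply_base (h : Hodograph I v p₀) : hodographMap v (hodographMap I p₀) = p₀ :=
  h.1.self_of_nhds

theorem symm (h : Hodograph I v p₀) : Hodograph v I (hodographMap I p₀) := by
  refine ⟨h.2, ?_⟩
  rw [h.apply_base]
  exact h.1

theorem tendsto (h : Hodograph I v p₀) (hv : SmoothNear v (hodographMap I p₀)) :
    Tendsto (hodographMap v) (𝓝 (hodographMap I p₀)) (𝓝 p₀) := by
  have := hv.hodographMap.continuousAt
  rwa [ContinuousAt, h.apply_base] at this

/-- A property that holds near `p₀` in the old variables may be checked in the new variables. -/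
theorem eventually_of_comp (h : Hodograph I v p₀) (hI : SmoothNear I p₀) {P : Pt ρ → Prop}
    (hP : ∀ᶠ q in 𝓝 (hodographMap I p₀), P (hodographMap v q)) : ∀ᶠ p in 𝓝 p₀, P p := by
  filter_upwards [hI.hodographMap.continuousAt.eventually hP, h.1] with p h1 h2
  rwa [h2] at h1

theorem eventually_jac_mul_jac (h : Hodograph I v p₀) (hI : SmoothNear I p₀)
    (hv : SmoothNear v (hodographMap I p₀)) :
    ∀ᶠ q in 𝓝 (hodographMap I p₀), jac I (hodographMap v q) * jac v q = 1 := by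
  filter_upwards [eventually_eventually_nhds.2 h.2, hv.eventually_differentiableAt,
    (h.tendsto hv).eventually hI.eventually_differentiableAt] with q h1 h2 h3
  rw [← jac_comp_hodographMap h3 h2]
  have h4 : (fun q => I (hodographMap v q)) =ᶠ[𝓝 q] fun q => q.2.2 := by
    filter_upwards [h1] with q' hq'
    exact congrArg (fun z => z.2.2) hq'
  ext a b
  have h5 : fderiv ℝ (fun q : Pt ρ => q.2.2) q = (ContinuousLinearMap.snd ℝ ℝ (Fin ρ → ℝ)).comp
      (ContinuousLinearMap.snd ℝ ℝ (ℝ × (Fin ρ → ℝ))) :=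
    (hasFDerivAt_snd.comp q hasFDerivAt_snd).fderiv
  simp [jac, pdU, h4.fderiv_eq, h5, Matrix.one_apply, Pi.single_apply]

theorem eventually_pdX_eq (h : Hodograph I v p₀) (hI : SmoothNear I p₀)
    (hv : SmoothNear v (hodographMap I p₀)) :
    ∀ᶠ q in 𝓝 (hodographMap I p₀), (jac I (hodographMap v q)).det ≠ 0 ∧
      pdX v q = -((jac I (hodographMap v q))⁻¹.mulVec (pdX I (hodographMap v q))) := by
  filter_upwards [eventually_eventually_nhds.2 h.2, hv.eventually_differentiableAt,
    (h.tendsto hv).eventually hI.eventually_differentiableAt, h.eventually_jac_mul_jac hI hv]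
    with q h1 h2 h3 h6
  have hdet : (jac I (hodographMap v q)).det ≠ 0 := by
    intro h0
    have := congrArg Matrix.det h6
    rw [Matrix.det_mul, h0, zero_mul, Matrix.det_one] at this
    exact zero_ne_one this
  refine ⟨hdet, ?_⟩
  have h4 : (fun q => I (hodographMap v q)) =ᶠ[𝓝 q] fun q => q.2.2 := by
    filter_upwards [h1] with q' hq'
    exact congrArg (fun z => z.2.2) hq'
  have h5 : fderiv ℝ (fun q : Pt ρ => q.2.2) q = (ContinuousLinearMap.snd ℝ ℝ (Fin ρ → ℝ)).comp
      (ContinuousLinearMap.snd ℝ ℝ (ℝ × (Fin ρ → ℝ))) :=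
    (hasFDerivAt_snd.comp q hasFDerivAt_snd).fderiv
  have h7 := pdX_comp_hodographMap h3 h2
  rw [sum_smul_pdU_eq_jac_mulVec, pdX, h4.fderiv_eq, h5] at h7
  have h8 : pdX I (hodographMap v q) = -(jac I (hodographMap v q)).mulVec (pdX v q) :=
    eq_neg_of_add_eq_zero_left h7.symm
  rw [h8, Matrix.mulVec_neg, neg_neg, Matrix.mulVec_mulVec,
    Matrix.nonsing_inv_mul _ (isUnit_iff_ne_zero.2 hdet), Matrix.one_mulVec]

/-- In the new variables the differential substitution reads `∂v/∂x̃ = θ(t̃, x̃, v)`. -/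
theorem diffSubstitution_iff (h : Hodograph I v p₀) (hI : SmoothNear I p₀)
    (hv : SmoothNear v (hodographMap I p₀)) {θ : Pt ρ → (Fin ρ → ℝ)} :
    DiffSubstitution I θ p₀ ↔
      ∀ᶠ q in 𝓝 (hodographMap I p₀), pdX v q = θ (hodographMap v q) := by
  constructor
  · intro hS
    filter_upwards [h.eventually_pdX_eq hI hv, (h.tendsto hv).eventually hS] with q h1 h2
    rw [h1.2, h2.2]
  · intro hS
    refine h.eventually_of_comp hI ?_
    filter_upwards [h.eventually_pdX_eq hI hv, hS] with q h1 h2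
    exact ⟨h1.1, by rw [← h2, h1.2]⟩

end Hodograph

/-- The inverse hodograph transformation. -/
theorem SmoothNear.exists_inverse_hodograph {v : Pt ρ → (Fin ρ → ℝ)} {q₀ : Pt ρ}
    (hv : SmoothNear v q₀) (hdet : (jac v q₀).det ≠ 0) :
    ∃ I : Pt ρ → (Fin ρ → ℝ), SmoothNear I (hodographMap v q₀) ∧
      hodographMap I (hodographMap v q₀) = q₀ ∧ Hodograph I v (hodographMap v q₀) := by
  obtain ⟨I, hI, hH⟩ := hv.exists_hodograph hdet
  exact ⟨I, hI, hH.apply_base, hH.symm⟩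

/-! ### Functions that do not depend on one of the variables -/

theorem hasDerivAt_pdX {f : Pt ρ → Y} {q : Pt ρ} (hf : DifferentiableAt ℝ f q) :
    HasDerivAt (fun s => f (q.1, s, q.2.2)) (pdX f q) q.2.1 :=
  HasFDerivAt.comp_hasDerivAt (l := f) (f := fun s => ((q.1, s, q.2.2) : Pt ρ)) q.2.1 hf.hasFDerivAt
    ((hasDerivAt_const _ _).prodMk ((hasDerivAt_id _).prodMk (hasDerivAt_const _ _)))

/-- A function that satisfies a linear differential inequality in `x` and vanishes on a
hyperplane `x = x₀` is zero. -/
theorem eventually_eq_zero_of_norm_pdX_le {w : Pt ρ → Y} {q₀ : Pt ρ} {K : ℝ}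
    (hw : ∀ᶠ q in 𝓝 q₀, DifferentiableAt ℝ w q ∧ ‖pdX w q‖ ≤ K * ‖w q‖)
    (h0 : ∀ᶠ q in 𝓝 q₀, w (q.1, q₀.2.1, q.2.2) = 0) : ∀ᶠ q in 𝓝 q₀, w q = 0 := by
  obtain ⟨δ, hδ, h⟩ := exists_ball_eq_zero_of_norm_fderiv_le hw
  have hc : Tendsto (fun q : Pt ρ => ((q.1, q₀.2.1, q.2.2) : Pt ρ)) (𝓝 q₀) (𝓝 q₀) := by
    have : ContinuousAt (fun q : Pt ρ => ((q.1, q₀.2.1, q.2.2) : Pt ρ)) q₀ := by fun_prop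
    exact this
  filter_upwards [h0, Metric.ball_mem_nhds q₀ hδ, hc.eventually (Metric.ball_mem_nhds q₀ hδ)]
    with q h1 h2 h3
  have h4 : q + (q₀.2.1 - q.2.1) • ((0, 1, 0) : Pt ρ) = (q.1, q₀.2.1, q.2.2) := by
    ext <;> simp
  exact h q h2 (q₀.2.1 - q.2.1) (by rwa [h4]) (by rwa [h4])

/-- A function with zero derivative in `x` does not depend on `x`. -/
theorem SmoothNear.eventually_eq_of_pdX_eq_zero {f : Pt ρ → Y} {q₀ : Pt ρ}
    (hf : SmoothNear f q₀) (h : ∀ᶠ q in 𝓝 q₀, pdX f q = 0) :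
    ∀ᶠ q in 𝓝 q₀, f q = f (q.1, q₀.2.1, q.2.2) := by
  let σ : Pt ρ → Pt ρ := fun q => (q.1, q₀.2.1, q.2.2)
  have hσ : ∀ q, HasFDerivAt σ ((ContinuousLinearMap.fst ℝ ℝ (ℝ × (Fin ρ → ℝ))).prod
      ((0 : Pt ρ →L[ℝ] ℝ).prod ((ContinuousLinearMap.snd ℝ ℝ (Fin ρ → ℝ)).comp
        (ContinuousLinearMap.snd ℝ ℝ (ℝ × (Fin ρ → ℝ)))))) q := fun q =>
    hasFDerivAt_fst.prodMk ((hasFDerivAt_const _ _).prodMk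
      (hasFDerivAt_snd.comp q hasFDerivAt_snd))
  have hc : Tendsto σ (𝓝 q₀) (𝓝 q₀) := (hσ q₀).continuousAt
  have key := eventually_eq_zero_of_norm_pdX_le (w := fun q => f q - f (σ q)) (q₀ := q₀) (K := 0)
    (by
      filter_upwards [hf.eventually_differentiableAt,
        hc.eventually hf.eventually_differentiableAt, h] with q h1 h2 h3
      have h4 := HasFDerivAt.comp (g := f) q h2.hasFDerivAt (hσ q)
      have h5 := h1.hasFDerivAt.sub h4
      refine ⟨h5.differentiableAt, ?_⟩
      have h6 : pdX (fun q => f q - f (σ q)) q = pdX f q - fderiv ℝ f (σ q) 0 :=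
        congrArg (fun L : Pt ρ →L[ℝ] Y => L (0, 1, 0)) h5.fderiv
      rw [h6, h3, map_zero, sub_zero, norm_zero, zero_mul])
    (Eventually.of_forall fun q => sub_self _)
  filter_upwards [key] with q hq
  exact sub_eq_zero.1 hq

theorem hasDerivAt_pdT {f : Pt ρ → Y} {q : Pt ρ} (hf : DifferentiableAt ℝ f q) :
    HasDerivAt (fun s => f (s, q.2.1, q.2.2)) (pdT f q) q.1 :=
  HasFDerivAt.comp_hasDerivAt (l := f) (f := fun s => ((s, q.2.1, q.2.2) : Pt ρ)) q.1 hf.hasFDerivAt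
    ((hasDerivAt_id _).prodMk ((hasDerivAt_const _ _).prodMk (hasDerivAt_const _ _)))

/-- A function with zero derivative in `t` does not depend on `t`. -/
theorem SmoothNear.eventually_eq_of_pdT_eq_zero {f : Pt ρ → Y} {q₀ : Pt ρ}
    (hf : SmoothNear f q₀) (h : ∀ᶠ q in 𝓝 q₀, pdT f q = 0) :
    ∀ᶠ q in 𝓝 q₀, f q = f (q₀.1, q.2.1, q.2.2) := by
  -- `σ` exchanges `t` and `x`
  let σ : Pt ρ → Pt ρ := fun q => (q.2.1, q.1, q.2.2)
  have hσ : ContDiff ℝ ∞ σ :=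
    (contDiff_fst.comp contDiff_snd).prodMk (contDiff_fst.prodMk (contDiff_snd.comp contDiff_snd))
  have hσt (q : Pt ρ) : Tendsto σ (𝓝 q) (𝓝 (σ q)) := hσ.continuous.continuousAt
  have hfσ : SmoothNear (fun q => f (σ q)) (σ q₀) := hf.comp_of_eq (hσ.smoothNear _) rfl
  have hx : ∀ᶠ q in 𝓝 (σ q₀), pdX (fun q => f (σ q)) q = 0 := by
    have h1 : ∀ᶠ q in 𝓝 (σ (σ q₀)), pdT f q = 0 := h
    filter_upwards [(hσt (σ q₀)).eventually h1, hfσ.eventually_differentiableAt,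
      (hσt (σ q₀)).eventually (hf.eventually_differentiableAt : ∀ᶠ q in 𝓝 (σ (σ q₀)), _)]
      with q h2 h3 h4
    exact (hasDerivAt_pdX h3).unique ((hasDerivAt_pdT h4).congr_deriv h2)
  exact (hσt q₀).eventually (hfσ.eventually_eq_of_pdX_eq_zero hx)

/-! ### The tuples `𝓘` with the same `θ` -/

/-- Tuples `𝓘` and `𝓘'` that represent the same `θ` are related by `𝓘' = G(t, 𝓘)`: in the new
variables, `𝓘'` does not depend on `x`. -/
theorem DiffSubstitution.gaugeRelated {I I' θ : Pt ρ → (Fin ρ → ℝ)} {p₀ : Pt ρ}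
    (hI : SmoothNear I p₀) (hI' : SmoothNear I' p₀) (h : DiffSubstitution I θ p₀)
    (h' : DiffSubstitution I' θ p₀) : GaugeRelated I I' p₀ := by
  obtain ⟨v, hv, hH⟩ := hI.exists_hodograph h.self_of_nhds.1
  have hvx := (hH.diffSubstitution_iff hI hv).1 h
  let w : Pt ρ → (Fin ρ → ℝ) := fun q => I' (hodographMap v q)
  have hw : SmoothNear w (hodographMap I p₀) := hI'.comp_of_eq hv.hodographMap hH.apply_base
  have hwx : ∀ᶠ q in 𝓝 (hodographMap I p₀), pdX w q = 0 := by
    filter_upwards [hvx, hv.eventually_differentiableAt, (hH.tendsto hv).eventually h',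
      (hH.tendsto hv).eventually hI'.eventually_differentiableAt] with q h1 h2 h3 h4
    rw [pdX_comp_hodographMap h4 h2, sum_smul_pdU_eq_jac_mulVec, h1, h3.2, Matrix.mulVec_neg,
      Matrix.mulVec_mulVec, Matrix.mul_nonsing_inv _ (isUnit_iff_ne_zero.2 h3.1),
      Matrix.one_mulVec, add_neg_cancel]
  have hconst := hw.eventually_eq_of_pdX_eq_zero hwx
  refine ⟨fun k => w (k.1, p₀.2.1, k.2), ?_, ?_, ?_⟩
  · have h1 : SmoothNear (fun k : ℝ × (Fin ρ → ℝ) => ((k.1, p₀.2.1, k.2) : Pt ρ))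
        (p₀.1, I p₀) :=
      (contDiff_fst.prodMk (contDiff_const.prodMk contDiff_snd)).smoothNear _
    exact hw.comp_of_eq h1 rfl
  · have h1 := det_fderiv_last_eq_det_jac hw.differentiableAt
    refine h1.trans_ne ?_
    have h2 : jac w (hodographMap I p₀) = _ := jac_comp_hodographMap
      (by rw [hH.apply_base]; exact hI'.differentiableAt) hv.differentiableAt
    rw [h2, Matrix.det_mul, hH.apply_base]
    refine mul_ne_zero h'.self_of_nhds.1 fun h0 => ?_
    have h3 := congrArg Matrix.det (hH.eventually_jac_mul_jac hI hv).self_of_nhds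
    rw [Matrix.det_mul, h0, mul_zero, Matrix.det_one] at h3
    exact zero_ne_one h3
  · filter_upwards [hI.hodographMap.continuousAt.eventually hconst, hH.1] with p h1 h2
    have h3 : w (hodographMap I p) = I' p := congrArg I' h2
    rw [← h3]
    exact h1

/-- If `𝓘' = G(t, 𝓘)`, then both `Ψ` and `𝓘_x` are multiplied on the left by the Jacobian matrix of
`G` with respect to its last argument, and this matrix cancels in `Ψ⁻¹ 𝓘_x`. -/
theorem GaugeRelated.diffSubstitution {I I' θ : Pt ρ → (Fin ρ → ℝ)} {p₀ : Pt ρ}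
    (hI : SmoothNear I p₀) (hG : GaugeRelated I I' p₀) (h : DiffSubstitution I θ p₀) :
    DiffSubstitution I' θ p₀ := by
  obtain ⟨G, hG, hdet, heq⟩ := hG
  let F : Pt ρ → (Fin ρ → ℝ) := fun q => G (q.1, q.2.2)
  have hproj : ∀ q : Pt ρ, HasFDerivAt (fun q : Pt ρ => (q.1, q.2.2))
      ((ContinuousLinearMap.fst ℝ ℝ (ℝ × (Fin ρ → ℝ))).prod
        ((ContinuousLinearMap.snd ℝ ℝ (Fin ρ → ℝ)).comp
        (ContinuousLinearMap.snd ℝ ℝ (ℝ × (Fin ρ → ℝ))))) q := fun q =>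
    hasFDerivAt_fst.prodMk (hasFDerivAt_snd.comp q hasFDerivAt_snd)
  have hF : SmoothNear F (hodographMap I p₀) :=
    hG.comp_of_eq ((contDiff_fst.prodMk (contDiff_snd.comp contDiff_snd)).smoothNear _) rfl
  have hFdet : (jac F (hodographMap I p₀)).det ≠ 0 := by
    rw [← det_fderiv_last_eq_det_jac hF.differentiableAt]
    exact hdet
  have hFx : ∀ᶠ q in 𝓝 (hodographMap I p₀), pdX F q = 0 := by
    have hc : Tendsto (fun q : Pt ρ => (q.1, q.2.2)) (𝓝 (hodographMap I p₀))
        (𝓝 (p₀.1, I p₀)) := (hproj (hodographMap I p₀)).continuousAt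
    filter_upwards [hc.eventually hG.eventually_differentiableAt] with q hq
    have h1 := (HasFDerivAt.comp (g := G) q hq.hasFDerivAt (hproj q)).fderiv
    have h2 : pdX F q = fderiv ℝ G (q.1, q.2.2) 0 :=
      congrArg (fun L : Pt ρ →L[ℝ] (Fin ρ → ℝ) => L (0, 1, 0)) h1
    rw [h2, map_zero]
  have hcI := hI.hodographMap.continuousAt
  filter_upwards [hcI.eventually hFx, hcI.eventually (hF.eventually_det_jac_ne_zero hFdet),
    hcI.eventually hF.eventually_differentiableAt, hI.eventually_differentiableAt, h,
    eventually_eventually_nhds.2 heq] with p h1 h2 h3 h4 h5 h6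
  have h7 : I' =ᶠ[𝓝 p] fun p => F (hodographMap I p) := h6
  have h8 : jac I' p = jac F (hodographMap I p) * jac I p := by
    rw [← jac_comp_hodographMap h3 h4]
    ext a b
    simp only [jac, pdU, h7.fderiv_eq]
  have h9 : pdX I' p = (jac F (hodographMap I p)).mulVec (pdX I p) := by
    rw [← sum_smul_pdU_eq_jac_mulVec, ← zero_add (∑ b, _), ← h1, ← pdX_comp_hodographMap h3 h4]
    simp only [pdX, h7.fderiv_eq]
  refine ⟨?_, ?_⟩
  · rw [h8, Matrix.det_mul]
    exact mul_ne_zero h2 h5.1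
  · rw [h5.2, h8, h9, Matrix.mulVec_mulVec, Matrix.mul_inv_rev, Matrix.mul_assoc,
      Matrix.nonsing_inv_mul _ (isUnit_iff_ne_zero.2 h2), Matrix.mul_one]

/-! ### Families with given initial values -/

/-- The system `∂v/∂x = θ(t, x, v)` of ordinary differential equations with the parameters `t`, `ϰ`
and the initial condition `v(t, x₀, ϰ) = y(t, ϰ)` has a smooth local solution. -/
theorem SmoothNear.exists_family {θ : Pt ρ → (Fin ρ → ℝ)} {p₀ : Pt ρ} (hθ : SmoothNear θ p₀)
    {y : ℝ × (Fin ρ → ℝ) → (Fin ρ → ℝ)} {k₀ : Fin ρ → ℝ} (hy : SmoothNear y (p₀.1, k₀))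
    (hy₀ : y (p₀.1, k₀) = p₀.2.2) :
    ∃ v : Pt ρ → (Fin ρ → ℝ), SmoothNear v (p₀.1, p₀.2.1, k₀) ∧
      (∀ᶠ q in 𝓝 ((p₀.1, p₀.2.1, k₀) : Pt ρ), pdX v q = θ (hodographMap v q)) ∧
      ∀ᶠ k in 𝓝 (p₀.1, k₀), v (k.1, p₀.2.1, k.2) = y k := by
  let V : Pt ρ → Pt ρ := fun p => (0, 1, θ p)
  have hV : SmoothNear V p₀ :=
    (contDiff_const.smoothNear _).prodMk ((contDiff_const.smoothNear _).prodMk hθ)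
  obtain ⟨φ, hφ, hφ0, hφd⟩ := hV.exists_flow
  -- the flow translates the `x`-axis and fixes `t`
  have hbase : ∀ᶠ p in 𝓝 ((0 : ℝ), p₀), (φ p).1 = p.2.1 ∧ (φ p).2.1 = p.2.2.1 + p.1 := by
    let w : ℝ × Pt ρ → ℝ × ℝ := fun p => ((φ p).1 - p.2.1, (φ p).2.1 - (p.2.2.1 + p.1))
    have hw : ∀ᶠ p in 𝓝 ((0 : ℝ), p₀), DifferentiableAt ℝ w p ∧
        ‖fderiv ℝ w p (1, 0)‖ ≤ 0 * ‖w p‖ := by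
      filter_upwards [hφ.eventually_differentiableAt, hφd] with p h1 h2
      have h3 : DifferentiableAt ℝ w p := by fun_prop
      refine ⟨h3, ?_⟩
      have h4 : HasDerivAt (fun s => w (s, p.2)) (fderiv ℝ w p (1, 0)) p.1 :=
        HasFDerivAt.comp_hasDerivAt (l := w) (f := fun s => (s, p.2)) p.1 h3.hasFDerivAt
          ((hasDerivAt_id _).prodMk (hasDerivAt_const _ _))
      have h5 : HasDerivAt (fun s => w (s, p.2)) (0 - 0, 1 - 1) p.1 := by
        refine HasDerivAt.prodMk ?_ ?_
        · exact (hasFDerivAt_fst.comp_hasDerivAt p.1 h2).sub (hasDerivAt_const p.1 p.2.1)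
        · exact (hasFDerivAt_fst.comp_hasDerivAt p.1 (hasFDerivAt_snd.comp_hasDerivAt p.1 h2)).sub
            ((hasDerivAt_id p.1).const_add p.2.2.1)
      rw [h4.unique h5]
      simp
    obtain ⟨δ, hδ, hball⟩ := exists_ball_eq_zero_of_norm_fderiv_le hw
    have hc : Tendsto (fun p : ℝ × Pt ρ => ((0 : ℝ), p.2)) (𝓝 (0, p₀)) (𝓝 (0, p₀)) := by
      have : ContinuousAt (fun p : ℝ × Pt ρ => ((0 : ℝ), p.2)) (0, p₀) := by fun_prop
      exact this
    have hc' : Tendsto (fun p : ℝ × Pt ρ => p.2) (𝓝 (0, p₀)) (𝓝 p₀) := continuousAt_snd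
    filter_upwards [Metric.ball_mem_nhds _ hδ, hc.eventually (Metric.ball_mem_nhds _ hδ),
      hc'.eventually hφ0] with p h1 h2 h3
    have h4 : p + (-p.1) • ((1, 0) : ℝ × Pt ρ) = (0, p.2) := by
      ext <;> simp
    have h5 := hball p h1 (-p.1) (by rwa [h4]) (by rw [h4]; simp [w, h3])
    exact ⟨sub_eq_zero.1 (congrArg Prod.fst h5), sub_eq_zero.1 (congrArg Prod.snd h5)⟩
  let j : Pt ρ → ℝ × Pt ρ := fun q => (q.2.1 - p₀.2.1, (q.1, p₀.2.1, y (q.1, q.2.2)))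
  have hj : SmoothNear j (p₀.1, p₀.2.1, k₀) := by
    have h1 : SmoothNear (fun q : Pt ρ => y (q.1, q.2.2)) (p₀.1, p₀.2.1, k₀) :=
      hy.comp_of_eq ((contDiff_fst.prodMk (contDiff_snd.comp contDiff_snd)).smoothNear _) rfl
    exact (((contDiff_fst.comp contDiff_snd).sub contDiff_const).smoothNear _).prodMk
      ((contDiff_fst.smoothNear _).prodMk ((contDiff_const.smoothNear _).prodMk h1))
  have hj0 : j (p₀.1, p₀.2.1, k₀) = (0, p₀) := by
    simp only [j, hy₀, sub_self]
  have hjt : Tendsto j (𝓝 (p₀.1, p₀.2.1, k₀)) (𝓝 (0, p₀)) := by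
    have := hj.continuousAt
    rwa [ContinuousAt, hj0] at this
  have hφj : SmoothNear (fun q => φ (j q)) (p₀.1, p₀.2.1, k₀) := hφ.comp_of_eq hj hj0
  have hv : SmoothNear (fun q => (φ (j q)).2.2) (p₀.1, p₀.2.1, k₀) :=
    SmoothNear.comp (g := fun z : Pt ρ => z.2.2) (f := fun q => φ (j q))
      ((contDiff_snd.comp contDiff_snd).smoothNear _) hφj
  refine ⟨fun q => (φ (j q)).2.2, hv, ?_, ?_⟩
  · filter_upwards [hv.eventually_differentiableAt, hjt.eventually hbase, hjt.eventually hφd]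
      with q h1 h2 h3
    have h4 := hasDerivAt_pdX h1
    have h5 := hasFDerivAt_snd.comp_hasDerivAt q.2.1 (hasFDerivAt_snd.comp_hasDerivAt q.2.1
      (HasDerivAt.scomp q.2.1 h3 ((hasDerivAt_id q.2.1).sub_const p₀.2.1)))
    rw [h4.unique h5]
    have h6 : φ (j q) = hodographMap (fun q => (φ (j q)).2.2) q :=
      Prod.ext h2.1 (Prod.ext (h2.2.trans (add_sub_cancel _ _)) rfl)
    rw [← h6]
    exact one_smul ℝ (θ (φ (j q)))
  · have hc : Tendsto (fun k : ℝ × (Fin ρ → ℝ) => ((k.1, p₀.2.1, y k) : Pt ρ))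
        (𝓝 (p₀.1, k₀)) (𝓝 p₀) := by
      have h1 : ContinuousAt (fun k : ℝ × (Fin ρ → ℝ) => ((k.1, p₀.2.1, y k) : Pt ρ))
          (p₀.1, k₀) := continuousAt_fst.prodMk (continuousAt_const.prodMk hy.continuousAt)
      rw [ContinuousAt, hy₀] at h1
      exact h1
    filter_upwards [hc.eventually hφ0] with k hk
    have h2 : j (k.1, p₀.2.1, k.2) = (0, (k.1, p₀.2.1, y k)) := by
      simp only [j, sub_self]
    rw [h2, hk]

/-- The solution of the same system is a family that is parametrized by the values at `(t₀, x₀)`, if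
`y(t₀, ϰ) = ϰ`. -/
theorem SmoothNear.exists_normalized_family {θ : Pt ρ → (Fin ρ → ℝ)} {p₀ : Pt ρ}
    (hθ : SmoothNear θ p₀) {y : ℝ × (Fin ρ → ℝ) → (Fin ρ → ℝ)}
    (hy : SmoothNear y (p₀.1, p₀.2.2)) (hy₀ : ∀ᶠ k in 𝓝 p₀.2.2, y (p₀.1, k) = k) :
    ∃ v : Pt ρ → (Fin ρ → ℝ), SmoothNear v p₀ ∧ hodographMap v p₀ = p₀ ∧ (jac v p₀).det ≠ 0 ∧
      (∀ᶠ q in 𝓝 p₀, pdX v q = θ (hodographMap v q)) ∧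
      ∀ᶠ k in 𝓝 (p₀.1, p₀.2.2), v (k.1, p₀.2.1, k.2) = y k := by
  obtain ⟨v, hv, hvx, hvy⟩ := hθ.exists_family hy hy₀.self_of_nhds
  refine ⟨v, hv, Prod.ext rfl (Prod.ext rfl (hvy.self_of_nhds.trans hy₀.self_of_nhds)), ?_, hvx,
    hvy⟩
  have hdet := det_fderiv_last_eq_det_jac hv.differentiableAt
  refine hdet.symm.trans_ne ?_
  have h1 : (fun k => v (p₀.1, p₀.2.1, k)) =ᶠ[𝓝 p₀.2.2] fun k => k := by
    have hc : Tendsto (fun k : Fin ρ → ℝ => (p₀.1, k)) (𝓝 p₀.2.2) (𝓝 (p₀.1, p₀.2.2)) :=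
      (by fun_prop : Continuous fun k : Fin ρ → ℝ => (p₀.1, k)).continuousAt
    filter_upwards [hc.eventually hvy, hy₀] with k h2 h3
    rw [h2, h3]
  change (fderiv ℝ (fun k => v (p₀.1, p₀.2.1, k)) p₀.2.2).det ≠ 0
  rw [h1.fderiv_eq, fderiv_fun_id]
  simp [ContinuousLinearMap.det]

/-- The initial value problem `∂y/∂t = K(t, y)`, `y(t₀, ϰ) = ϰ`. -/
theorem SmoothNear.exists_time_flow {K : Pt ρ → (Fin ρ → ℝ)} {p₀ : Pt ρ} (hK : SmoothNear K p₀) :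
    ∃ y : ℝ × (Fin ρ → ℝ) → (Fin ρ → ℝ), SmoothNear y (p₀.1, p₀.2.2) ∧
      (∀ᶠ k in 𝓝 p₀.2.2, y (p₀.1, k) = k) ∧
      ∀ᶠ k in 𝓝 (p₀.1, p₀.2.2),
        HasDerivAt (fun t => y (t, k.2)) (K (k.1, p₀.2.1, y k)) k.1 := by
  -- `t` plays the part of `x` in the initial value problem in `x`, and the first variable is idle
  let F : Pt ρ → (Fin ρ → ℝ) := fun p => K (p.2.1, p₀.2.1, p.2.2)
  have hF : SmoothNear F (0, p₀.1, p₀.2.2) := by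
    have h1 : SmoothNear (fun p : Pt ρ => ((p.2.1, p₀.2.1, p.2.2) : Pt ρ)) (0, p₀.1, p₀.2.2) :=
      ((contDiff_fst.comp contDiff_snd).prodMk
        (contDiff_const.prodMk (contDiff_snd.comp contDiff_snd))).smoothNear _
    exact hK.comp_of_eq h1 rfl
  obtain ⟨V, hV, hVx, hV0⟩ := hF.exists_family (y := fun k => k.2) (k₀ := p₀.2.2)
    (contDiff_snd.smoothNear _) rfl
  have hι : ContDiff ℝ ∞ fun k : ℝ × (Fin ρ → ℝ) => ((0, k.1, k.2) : Pt ρ) :=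
    contDiff_const.prodMk (contDiff_fst.prodMk contDiff_snd)
  have hιt : Tendsto (fun k : ℝ × (Fin ρ → ℝ) => ((0, k.1, k.2) : Pt ρ)) (𝓝 (p₀.1, p₀.2.2))
      (𝓝 (0, p₀.1, p₀.2.2)) := hι.continuous.continuousAt
  refine ⟨fun k => V (0, k.1, k.2), hV.comp_of_eq (hι.smoothNear _) rfl, ?_, ?_⟩
  · have hc : Tendsto (fun k : Fin ρ → ℝ => ((0 : ℝ), k)) (𝓝 p₀.2.2) (𝓝 (0, p₀.2.2)) :=
      (by fun_prop : Continuous fun k : Fin ρ → ℝ => ((0 : ℝ), k)).continuousAt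
    exact hc.eventually hV0
  · filter_upwards [hιt.eventually hVx, hιt.eventually hV.eventually_differentiableAt] with k h1 h2
    have h3 := hasDerivAt_pdX h2
    rw [h1] at h3
    exact h3

end HodographCalculus

/-! ### Total derivatives along a family -/

section TotalDerivatives

variable {ρ r : ℕ} {Y : Type*} [NormedAddCommGroup Y] [NormedSpace ℝ Y]

theorem pdX_congr {f g : Pt ρ → Y} {q : Pt ρ} (h : f =ᶠ[𝓝 q] g) : pdX f q = pdX g q := by
  rw [pdX, pdX, h.fderiv_eq]

theorem pdT_congr {f g : Pt ρ → Y} {q : Pt ρ} (h : f =ᶠ[𝓝 q] g) : pdT f q = pdT g q := by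
  rw [pdT, pdT, h.fderiv_eq]

theorem pdX_iterate_congr {f g : Pt ρ → Y} {q : Pt ρ} (h : f =ᶠ[𝓝 q] g) (k : ℕ) :
    pdX^[k] f =ᶠ[𝓝 q] pdX^[k] g := by
  induction k with
  | zero => exact h
  | succ k ih =>
    simp only [Function.iterate_succ_apply']
    filter_upwards [eventually_eventually_nhds.2 ih] with q' hq'
    exact pdX_congr hq'

theorem SmoothNear.pdX_iterate {f : Pt ρ → Y} {q : Pt ρ} (hf : SmoothNear f q) (k : ℕ) :
    SmoothNear (pdX^[k] f) q := by
  induction k with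
  | zero => exact hf
  | succ k ih => rw [Function.iterate_succ_apply']; exact ih.pdX

theorem SmoothNear.eventually_pdT_pdX_iterate {f : Pt ρ → Y} {q : Pt ρ} (hf : SmoothNear f q)
    (k : ℕ) : pdT (pdX^[k] f) =ᶠ[𝓝 q] pdX^[k] (pdT f) := by
  induction k with
  | zero => rfl
  | succ k ih =>
    simp only [Function.iterate_succ_apply']
    filter_upwards [eventually_eventually_nhds.2 ih, (hf.pdX_iterate k).eventually] with q' h1 h2
    rw [pdT_pdX h2]
    exact pdX_congr h1

protected theorem SmoothNear.hatDx {η f : Pt ρ → ℝ} {p : Pt ρ} (hη : SmoothNear η p)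
    (hf : SmoothNear f p) : SmoothNear (hatDx η f) p := by
  have h : ∀ b : Fin ρ, SmoothNear (fun p : Pt ρ =>
      if h : (b : ℕ) + 1 < ρ then p.2.2 ⟨(b : ℕ) + 1, h⟩ else η p) p := by
    intro b
    by_cases hb : (b : ℕ) + 1 < ρ
    · simp only [hb, dif_pos]
      exact ((contDiff_apply ℝ ℝ (⟨(b : ℕ) + 1, hb⟩ : Fin ρ)).comp
        (contDiff_snd.comp contDiff_snd)).smoothNear p
    · simp only [hb, dif_neg, not_false_eq_true]
      exact hη
  filter_upwards [hf.pdX, eventually_all.2 h, eventually_all.2 fun b => hf.pdU b] with q h1 h2 h3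
  exact h1.add (ContDiffAt.sum fun b _ => (h2 b).mul (h3 b))

theorem SmoothNear.hatDx_iterate {η f : Pt ρ → ℝ} {p : Pt ρ} (hη : SmoothNear η p)
    (hf : SmoothNear f p) (k : ℕ) : SmoothNear ((hatDx η)^[k] f) p := by
  induction k with
  | zero => exact hf
  | succ k ih => rw [Function.iterate_succ_apply']; exact hη.hatDx ih

protected theorem SmoothNear.hatJet {η : Pt ρ → ℝ} {p : Pt ρ} (hη : SmoothNear η p) (r : ℕ) :
    SmoothNear (hatJet r η) p := by
  refine (contDiff_fst.smoothNear p).prodMk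
    (((contDiff_fst.comp contDiff_snd).smoothNear p).prodMk (SmoothNear.pi fun k => ?_))
  by_cases hk : (k : ℕ) < ρ
  · simp only [hatU, hk, dif_pos]
    exact ((contDiff_apply ℝ ℝ (⟨k, hk⟩ : Fin ρ)).comp
      (contDiff_snd.comp contDiff_snd)).smoothNear p
  · simp only [hatU, hk, dif_neg, not_false_eq_true]
    exact hη.hatDx_iterate hη _

protected theorem SmoothNear.hatH {η : Pt ρ → ℝ} {p : Pt ρ} (hη : SmoothNear η p)
    (E : EvolutionEquation r) (hp : hatJet r η p ∈ E.domain) : SmoothNear (hatH E η) p := by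
  have hH : SmoothNear E.H (hatJet r η p) := by
    filter_upwards [E.isOpen_domain.mem_nhds hp] with z hz
    exact E.smooth_H.contDiffAt (E.isOpen_domain.mem_nhds hz)
  exact hH.comp (hη.hatJet r)

/-- The tuple `v` satisfies `∂v^{b-1}/∂x̃ = v^b` for `b < ρ` and `∂v^{ρ-1}/∂x̃ = η(t̃, x̃, v)`
near `q₀`: each of the curves `x̃ ↦ v(t̃, x̃, ϰ)` is the jet of a solution of the ordinary
differential equation `u_ρ = η`. -/
def SolvesJetODE (η : Pt ρ → ℝ) (v : Pt ρ → (Fin ρ → ℝ)) (q₀ : Pt ρ) : Prop :=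
  ∀ᶠ q in 𝓝 q₀, ∀ b : Fin ρ,
    pdX v q b = if h : (b : ℕ) + 1 < ρ then v q ⟨(b : ℕ) + 1, h⟩ else η (hodographMap v q)

/-- The tuple `v` satisfies `∂v^b/∂t̃ = (D̂_x^b Ĥ)(t̃, x̃, v)` near `q₀`. -/
def SolvesTimeODE (E : EvolutionEquation r) (η : Pt ρ → ℝ) (v : Pt ρ → (Fin ρ → ℝ))
    (q₀ : Pt ρ) : Prop :=
  ∀ᶠ q in 𝓝 q₀, ∀ b : Fin ρ, pdT v q b = (hatDx η)^[(b : ℕ)] (hatH E η) (hodographMap v q)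

namespace SolvesJetODE

variable {η : Pt ρ → ℝ} {v : Pt ρ → (Fin ρ → ℝ)} {q₀ : Pt ρ} {E : EvolutionEquation r}

/-- Along `v`, the operator `D̂_x` is the partial derivative with respect to `x̃`. -/
theorem eventually_hatDx_comp (h : SolvesJetODE η v q₀) (hv : SmoothNear v q₀) {f : Pt ρ → ℝ}
    (hf : SmoothNear f (hodographMap v q₀)) :
    ∀ᶠ q in 𝓝 q₀, hatDx η f (hodographMap v q) = pdX (fun q => f (hodographMap v q)) q := by
  filter_upwards [h, hv.eventually_differentiableAt,
    hv.hodographMap.continuousAt.eventually hf.eventually_differentiableAt] with q h1 h2 h3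
  rw [pdX_comp_hodographMap h3 h2, hatDx]
  congr 1
  refine Finset.sum_congr rfl fun b _ => ?_
  rw [h1 b, smul_eq_mul]
  rfl

theorem eventually_hatDx_iterate_comp (h : SolvesJetODE η v q₀) (hv : SmoothNear v q₀)
    (hη : SmoothNear η (hodographMap v q₀)) {f : Pt ρ → ℝ}
    (hf : SmoothNear f (hodographMap v q₀)) (k : ℕ) :
    (fun q => (hatDx η)^[k] f (hodographMap v q)) =ᶠ[𝓝 q₀]
      pdX^[k] (fun q => f (hodographMap v q)) := by
  induction k with
  | zero => rfl
  | succ k ih =>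
    simp only [Function.iterate_succ_apply']
    filter_upwards [eventually_eventually_nhds.2 ih,
      h.eventually_hatDx_comp hv (hη.hatDx_iterate hf k)] with q h1 h2
    rw [h2]
    exact pdX_congr h1

/-- By the determining equation the differences `w^b = ∂v^b/∂t̃ - D̂_x^b Ĥ` satisfy a homogeneous
linear system of ordinary differential equations in `x̃`. Hence they vanish if they vanish for one
value of `x̃`. -/
theorem solvesTimeODE_of_initial (h : SolvesJetODE η v q₀) (hv : SmoothNear v q₀)
    (hη : SmoothNear η (hodographMap v q₀))
    (hdet : ∀ᶠ p in 𝓝 (hodographMap v q₀), hatJet r η p ∈ E.domain ∧ DeterminingEqAt E η p)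
    (hinit : ∀ᶠ q in 𝓝 q₀, ∀ b : Fin ρ, pdT v (q.1, q₀.2.1, q.2.2) b =
      (hatDx η)^[(b : ℕ)] (hatH E η) (hodographMap v (q.1, q₀.2.1, q.2.2))) :
    SolvesTimeODE E η v q₀ := by
  have hH : SmoothNear (hatH E η) (hodographMap v q₀) := hη.hatH E hdet.self_of_nhds.1
  have hHk : ∀ k, SmoothNear ((hatDx η)^[k] (hatH E η)) (hodographMap v q₀) := fun k =>
    hη.hatDx_iterate hH k
  have hcv := hv.hodographMap.continuousAt
  let w : Pt ρ → (Fin ρ → ℝ) := fun q b =>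
    pdT v q b - (hatDx η)^[(b : ℕ)] (hatH E η) (hodographMap v q)
  have hw : SmoothNear w q₀ := by
    refine SmoothNear.pi fun b => ?_
    filter_upwards [hv.pdT.component b, (hHk b).comp hv.hodographMap] with q h1 h2
    exact h1.sub h2
  -- the derivatives of the components of `w`
  have hwx : ∀ b : Fin ρ, ∀ᶠ q in 𝓝 q₀, pdX w q b = pdT (fun q => pdX v q b) q -
      (hatDx η)^[(b : ℕ) + 1] (hatH E η) (hodographMap v q) := by
    intro b
    filter_upwards [hw.eventually_differentiableAt, hv.eventually,
      hv.eventually_differentiableAt.eventually_nhds, hcv.eventually (hHk b).eventually,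
      h.eventually_hatDx_comp hv (hHk b)] with q h1 h2 h3 h4 h5
    have h6 : DifferentiableAt ℝ (fun q => pdT v q b) q := (h2.pdT.component b).differentiableAt
    have h7 : DifferentiableAt ℝ
        (fun q => (hatDx η)^[(b : ℕ)] (hatH E η) (hodographMap v q)) q :=
      (h4.comp h2.hodographMap).differentiableAt
    have h8 : pdT (fun q => pdX v q b) q = pdX (fun q => pdT v q b) q := by
      have e1 : (fun q => pdX v q b) =ᶠ[𝓝 q] pdX fun q => v q b :=
        h3.mono fun q' hq' => (pdX_apply hq' b).symm
      have e2 : (fun q => pdT v q b) =ᶠ[𝓝 q] pdT fun q => v q b :=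
        h3.mono fun q' hq' => (pdT_apply hq' b).symm
      rw [pdT_congr e1, pdX_congr e2, pdT_pdX (h2.component b)]
    rw [← pdX_apply h1, h8, Function.iterate_succ_apply', h5]
    simp only [pdX, w, fderiv_fun_sub h6 h7, sub_apply]
  -- near `q₀` the coefficients of the linear system are bounded by `M q₀ + 1`
  let M : Pt ρ → ℝ := fun q => ∑ c, |pdU c η (hodographMap v q)|
  have hM : ∀ᶠ q in 𝓝 q₀, M q < M q₀ + 1 := by
    have hMc : ContinuousAt M q₀ :=
      tendsto_finsetSum _ fun c _ => ((hη.pdU c).comp hv.hodographMap).continuousAt.abs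
    exact hMc.eventually (gt_mem_nhds (lt_add_one _))
  have hM0 : 0 ≤ M q₀ := Finset.sum_nonneg fun c _ => abs_nonneg _
  have key : ∀ᶠ q in 𝓝 q₀, DifferentiableAt ℝ w q ∧ ‖pdX w q‖ ≤ (M q₀ + 1) * ‖w q‖ := by
    filter_upwards [hw.eventually_differentiableAt, eventually_all.2 hwx, hM,
      eventually_eventually_nhds.2 h, hv.eventually_differentiableAt,
      hcv.eventually hη.eventually_differentiableAt, hcv.eventually hdet]
      with q h1 h2 h3 h4 h5 h6 h7
    refine ⟨h1, (pi_norm_le_iff_of_nonneg (by positivity)).2 fun b => ?_⟩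
    by_cases hb : (b : ℕ) + 1 < ρ
    -- `∂w^b/∂x̃ = w^{b+1}` for `b + 1 < ρ`, and `∂w^{ρ-1}/∂x̃ = ∑ w^c ∂η/∂u_c`
    · have e1 : (fun q => pdX v q b) =ᶠ[𝓝 q] fun q => v q ⟨(b : ℕ) + 1, hb⟩ :=
        h4.mono fun q' hq' => (hq' b).trans (dif_pos hb)
      rw [h2 b, pdT_congr e1, pdT_apply h5]
      exact (norm_le_pi_norm (w q) ⟨(b : ℕ) + 1, hb⟩).trans
        (le_mul_of_one_le_left (norm_nonneg _) (by linarith))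
    · have e1 : (fun q => pdX v q b) =ᶠ[𝓝 q] fun q => η (hodographMap v q) :=
        h4.mono fun q' hq' => (hq' b).trans (dif_neg hb)
      have hbρ : (b : ℕ) + 1 = ρ := by have := b.2; omega
      have e2 : pdX w q b = ∑ c, w q c * pdU c η (hodographMap v q) := by
        rw [h2 b, pdT_congr e1, pdT_comp_hodographMap h6 h5, hbρ, ← h7.2, hatDt,
          add_sub_add_left_eq_sub, ← Finset.sum_sub_distrib]
        exact Finset.sum_congr rfl fun c _ => by simp only [w, smul_eq_mul]; ring
      rw [e2]
      calc ‖∑ c, w q c * pdU c η (hodographMap v q)‖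
          ≤ ∑ c, ‖w q‖ * |pdU c η (hodographMap v q)| := by
            refine norm_sum_le_of_le _ fun c _ => ?_
            rw [norm_mul, Real.norm_eq_abs (pdU c η _)]
            exact mul_le_mul_of_nonneg_right (norm_le_pi_norm (w q) c) (abs_nonneg _)
        _ = M q * ‖w q‖ := by rw [← Finset.mul_sum, mul_comm]
        _ ≤ (M q₀ + 1) * ‖w q‖ := mul_le_mul_of_nonneg_right h3.le (norm_nonneg _)
  have hzero := eventually_eq_zero_of_norm_pdX_le key (by
    filter_upwards [hinit] with q hq
    exact funext fun b => sub_eq_zero.2 (hq b))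
  filter_upwards [hzero] with q hq b
  exact sub_eq_zero.1 (congrFun hq b)

end SolvesJetODE

variable [NeZero ρ]

protected theorem SmoothNear.tildeU {v : Pt ρ → (Fin ρ → ℝ)} {q : Pt ρ} (hv : SmoothNear v q) :
    SmoothNear (tildeU v) q := hv.component 0

protected theorem SmoothNear.lastComp {θ : Pt ρ → (Fin ρ → ℝ)} {p : Pt ρ} (hθ : SmoothNear θ p) :
    SmoothNear (lastComp θ) p := hθ.component _

/-- The equations `v^{b-1} = ∂^{b-1}ũ/∂x̃^{b-1}` in the form of equations of first order. -/
theorem derivativeEqs_iff {v : Pt ρ → (Fin ρ → ℝ)} {q₀ : Pt ρ} (hv : SmoothNear v q₀) :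
    DerivativeEqs v q₀ ↔ ∀ᶠ q in 𝓝 q₀, ∀ (a : ℕ) (h : a + 1 < ρ),
      pdX v q ⟨a, by omega⟩ = v q ⟨a + 1, h⟩ := by
  constructor
  · intro H
    filter_upwards [eventually_eventually_nhds.2 H, hv.eventually_differentiableAt] with q h1 h2
    intro a ha
    rw [← pdX_apply h2, h1.self_of_nhds ⟨a + 1, ha⟩, Function.iterate_succ_apply']
    exact pdX_congr (h1.mono fun q' hq' => hq' _)
  · intro H
    have key : ∀ (b : ℕ) (hb : b < ρ), ∀ᶠ q in 𝓝 q₀, v q ⟨b, hb⟩ = pdX^[b] (tildeU v) q := by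
      intro b
      induction b with
      | zero => exact fun hb => Eventually.of_forall fun q => rfl
      | succ b ih =>
        intro hb
        filter_upwards [eventually_eventually_nhds.2 (ih (by omega)), H,
          hv.eventually_differentiableAt] with q h1 h2 h3
        rw [← h2 b hb, ← pdX_apply h3, Function.iterate_succ_apply']
        exact pdX_congr h1
    exact eventually_all.2 fun b => key b b.2

theorem AlgebraicEqs.derivativeEqs {v θ : Pt ρ → (Fin ρ → ℝ)} {q₀ : Pt ρ}
    (h : AlgebraicEqs θ (hodographMap v q₀)) (hv : SmoothNear v q₀)
    (hS : ∀ᶠ q in 𝓝 q₀, pdX v q = θ (hodographMap v q)) : DerivativeEqs v q₀ := by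
  rw [derivativeEqs_iff hv]
  filter_upwards [hS, hv.hodographMap.continuousAt.eventually h] with q h1 h2
  intro a ha
  rw [h1, h2 a ha]
  rfl

/-- In the new variables the equations `θ^a = u_a` read `v^{b-1} = ∂^{b-1}ũ/∂x̃^{b-1}`. -/
theorem Hodograph.algebraicEqs_iff {I v θ : Pt ρ → (Fin ρ → ℝ)} {p₀ : Pt ρ}
    (h : Hodograph I v p₀) (hI : SmoothNear I p₀) (hv : SmoothNear v (hodographMap I p₀))
    (hS : ∀ᶠ q in 𝓝 (hodographMap I p₀), pdX v q = θ (hodographMap v q)) :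
    AlgebraicEqs θ p₀ ↔ DerivativeEqs v (hodographMap I p₀) := by
  constructor
  · intro H
    rw [← h.apply_base] at H
    exact H.derivativeEqs hv hS
  · intro H
    refine h.eventually_of_comp hI ?_
    filter_upwards [hS, (derivativeEqs_iff hv).1 H] with q h1 h2
    intro a ha
    rw [← h1, h2 a ha]
    rfl

theorem DerivativeEqs.solvesJetODE {v θ : Pt ρ → (Fin ρ → ℝ)} {q₀ : Pt ρ}
    (h : DerivativeEqs v q₀) (hv : SmoothNear v q₀)
    (hS : ∀ᶠ q in 𝓝 q₀, pdX v q = θ (hodographMap v q)) : SolvesJetODE (lastComp θ) v q₀ := by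
  filter_upwards [(derivativeEqs_iff hv).1 h, hS] with q h1 h2
  intro b
  by_cases hb : (b : ℕ) + 1 < ρ
  · rw [dif_pos hb]
    exact h1 b hb
  · rw [dif_neg hb, h2, lastComp]
    have hb' : b = ⟨ρ - 1, Nat.sub_lt (NeZero.pos ρ) Nat.one_pos⟩ :=
      Fin.ext (by have := b.2; change (b : ℕ) = ρ - 1; omega)
    rw [hb']

namespace SolvesJetODE

variable {η : Pt ρ → ℝ} {v : Pt ρ → (Fin ρ → ℝ)} {q₀ : Pt ρ} {E : EvolutionEquation r}

theorem derivativeEqs (h : SolvesJetODE η v q₀) (hv : SmoothNear v q₀) : DerivativeEqs v q₀ := by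
  rw [derivativeEqs_iff hv]
  filter_upwards [h] with q hq a ha
  rw [hq, dif_pos ha]

theorem eventually_comp_eq_iterate (h : SolvesJetODE η v q₀) (hv : SmoothNear v q₀) :
    (fun q => η (hodographMap v q)) =ᶠ[𝓝 q₀] pdX^[ρ] (tildeU v) := by
  obtain ⟨m, hm⟩ : ∃ m, ρ = m + 1 := Nat.exists_eq_succ_of_ne_zero (NeZero.ne ρ)
  have hmρ : m < ρ := by omega
  filter_upwards [h, eventually_eventually_nhds.2 (h.derivativeEqs hv),
    hv.eventually_differentiableAt] with q h1 h2 h3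
  have h4 := h1 ⟨m, hmρ⟩
  rw [dif_neg (by change ¬ (m + 1 < ρ); omega), ← pdX_apply h3] at h4
  have h5 : pdX^[ρ] (tildeU v) q = pdX (pdX^[m] (tildeU v)) q := by
    have h6 : pdX^[ρ] (tildeU v) q = pdX^[m + 1] (tildeU v) q := by rw [← hm]
    rw [h6, Function.iterate_succ_apply']
  rw [← h4, h5]
  exact pdX_congr (h2.mono fun q' hq' => hq' ⟨m, hmρ⟩)

/-- Along `v`, the functions `û_k` are the derivatives of `ũ` with respect to `x̃`. -/
theorem eventually_hatU_comp (h : SolvesJetODE η v q₀) (hv : SmoothNear v q₀)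
    (hη : SmoothNear η (hodographMap v q₀)) (k : ℕ) :
    ∀ᶠ q in 𝓝 q₀, hatU η k (hodographMap v q) = pdX^[k] (tildeU v) q := by
  by_cases hk : k < ρ
  · filter_upwards [h.derivativeEqs hv] with q hq
    simp only [hatU, hk, dif_pos]
    exact hq ⟨k, hk⟩
  · have h1 : pdX^[k] (tildeU v) = pdX^[k - ρ] (pdX^[ρ] (tildeU v)) := by
      rw [← Function.iterate_add_apply]
      congr 1
      omega
    filter_upwards [h.eventually_hatDx_iterate_comp hv hη hη (k - ρ),
      pdX_iterate_congr (h.eventually_comp_eq_iterate hv) (k - ρ)] with q h2 h3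
    simp only [hatU, hk, dif_neg, not_false_eq_true]
    rw [h2, h3, h1]

theorem eventually_hatJet_comp (h : SolvesJetODE η v q₀) (hv : SmoothNear v q₀)
    (hη : SmoothNear η (hodographMap v q₀)) (r : ℕ) :
    ∀ᶠ q in 𝓝 q₀, hatJet r η (hodographMap v q) = xJet r (tildeU v) q := by
  filter_upwards [eventually_all.2 fun k : Fin (r + 1) => h.eventually_hatU_comp hv hη k] with q hq
  exact Prod.ext rfl (Prod.ext rfl (funext hq))

/-- A solution `ũ` of the evolution equation satisfies `∂v^b/∂t̃ = D̂_x^b Ĥ`. -/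
theorem solvesTimeODE (h : SolvesJetODE η v q₀) (hv : SmoothNear v q₀)
    (hη : SmoothNear η (hodographMap v q₀)) (hE : SolvesEvolutionEq E (tildeU v) q₀) :
    SolvesTimeODE E η v q₀ := by
  have hjet := h.eventually_hatJet_comp hv hη r
  have hH : SmoothNear (hatH E η) (hodographMap v q₀) :=
    hη.hatH E (by rw [hjet.self_of_nhds]; exact hE.self_of_nhds.1)
  have hut : pdT (tildeU v) =ᶠ[𝓝 q₀] fun q => hatH E η (hodographMap v q) := by
    filter_upwards [hE, hjet] with q h1 h2
    rw [h1.2, hatH, h2]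
  refine eventually_all.2 fun b => ?_
  filter_upwards [eventually_eventually_nhds.2 (h.derivativeEqs hv), hv.eventually_differentiableAt,
    hv.tildeU.eventually_pdT_pdX_iterate b, pdX_iterate_congr hut b,
    h.eventually_hatDx_iterate_comp hv hη hH b] with q h1 h2 h3 h4 h5
  rw [h5, ← h4, ← h3, ← pdT_apply h2]
  exact pdT_congr (h1.mono fun q' hq' => hq' b)

/-- Along a solution `v` of the initial system the determining equation says that
`∂_t̃ ∂_x̃^ρ ũ = ∂_x̃^ρ ∂_t̃ ũ`. -/
theorem eventually_determiningEqAt (h : SolvesJetODE η v q₀) (hv : SmoothNear v q₀)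
    (hη : SmoothNear η (hodographMap v q₀)) (hE : SolvesEvolutionEq E (tildeU v) q₀) :
    ∀ᶠ q in 𝓝 q₀, hatJet r η (hodographMap v q) ∈ E.domain ∧
      DeterminingEqAt E η (hodographMap v q) := by
  have hjet := h.eventually_hatJet_comp hv hη r
  have hH : SmoothNear (hatH E η) (hodographMap v q₀) :=
    hη.hatH E (by rw [hjet.self_of_nhds]; exact hE.self_of_nhds.1)
  have hut : pdT (tildeU v) =ᶠ[𝓝 q₀] fun q => hatH E η (hodographMap v q) := by
    filter_upwards [hE, hjet] with q h1 h2
    rw [h1.2, hatH, h2]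
  filter_upwards [hE, hjet, h.solvesTimeODE hv hη hE, hv.eventually_differentiableAt,
    hv.hodographMap.continuousAt.eventually hη.eventually_differentiableAt,
    hv.tildeU.eventually_pdT_pdX_iterate ρ, pdX_iterate_congr hut ρ,
    h.eventually_hatDx_iterate_comp hv hη hH ρ,
    eventually_eventually_nhds.2 (h.eventually_comp_eq_iterate hv)]
    with q h1 h2 h3 h4 h5 h6 h7 h8 h9
  refine ⟨by rw [h2]; exact h1.1, ?_⟩
  have h10 : hatDt E η η (hodographMap v q) = pdT (fun q => η (hodographMap v q)) q := by
    rw [pdT_comp_hodographMap h5 h4, hatDt]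
    congr 1
    exact Finset.sum_congr rfl fun b _ => by rw [h3 b, smul_eq_mul]
  rw [DeterminingEqAt, h10, h8, ← h7, ← h6]
  exact pdT_congr h9

theorem solvesEvolutionEq (h : SolvesJetODE η v q₀) (hv : SmoothNear v q₀)
    (hη : SmoothNear η (hodographMap v q₀)) (ht : SolvesTimeODE E η v q₀)
    (hdom : ∀ᶠ p in 𝓝 (hodographMap v q₀), hatJet r η p ∈ E.domain) :
    SolvesEvolutionEq E (tildeU v) q₀ := by
  filter_upwards [h.eventually_hatJet_comp hv hη r, ht, hv.eventually_differentiableAt,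
    hv.hodographMap.continuousAt.eventually hdom] with q h1 h2 h3 h4
  rw [← h1]
  refine ⟨h4, ?_⟩
  have h5 : pdT (tildeU v) q = pdT v q 0 := pdT_apply h3 0
  rw [h5, h2 0, Fin.val_zero]
  rfl

end SolvesJetODE

end TotalDerivatives

/-! ### Families of solutions -/

section Families

variable {ρ r : ℕ} [NeZero ρ]

/-- For each solution `θ` of the determining system there is a family of solutions of the initial
system: the common integral of the commuting fields `D̂_x` and `D̂_t`, which takes the value `ϰ`
at `(t₀, x₀)`. -/
theorem SolvesDeterminingSystem.exists_family {E : EvolutionEquation r}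
    {θ : Pt ρ → (Fin ρ → ℝ)} {p₀ : Pt ρ} (h : SolvesDeterminingSystem E θ p₀)
    (hθ : SmoothNear θ p₀) :
    ∃ v : Pt ρ → (Fin ρ → ℝ), SmoothNear v p₀ ∧ hodographMap v p₀ = p₀ ∧ (jac v p₀).det ≠ 0 ∧
      (∀ᶠ q in 𝓝 p₀, pdX v q = θ (hodographMap v q)) ∧ SolvesInitialSystem E v p₀ := by
  obtain ⟨halg, hdet⟩ := h
  have hη : SmoothNear (lastComp θ) p₀ := hθ.lastComp
  have hH : SmoothNear (hatH E (lastComp θ)) p₀ := hη.hatH E hdet.self_of_nhds.1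
  let K : Pt ρ → (Fin ρ → ℝ) := fun p b => (hatDx (lastComp θ))^[(b : ℕ)] (hatH E (lastComp θ)) p
  have hK : SmoothNear K p₀ := SmoothNear.pi fun b => hη.hatDx_iterate hH b
  obtain ⟨y, hy, hy0, hyt⟩ := hK.exists_time_flow
  obtain ⟨v, hv, hv0, hvdet, hvx, hvy⟩ := hθ.exists_normalized_family hy hy0
  rw [← hv0] at halg
  have hder := halg.derivativeEqs hv hvx
  have hode := hder.solvesJetODE hv hvx
  have hη' : SmoothNear (lastComp θ) (hodographMap v p₀) := by rwa [hv0]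
  have hdet' : ∀ᶠ p in 𝓝 (hodographMap v p₀), hatJet r (lastComp θ) p ∈ E.domain ∧
      DeterminingEqAt E (lastComp θ) p := by rwa [hv0]
  refine ⟨v, hv, hv0, hvdet, hvx, hder, hode.solvesEvolutionEq hv hη'
    (hode.solvesTimeODE_of_initial hv hη' hdet' ?_) (hdet'.mono fun p hp => hp.1)⟩
  have hc1 : Tendsto (fun q : Pt ρ => (q.1, q.2.2)) (𝓝 p₀) (𝓝 (p₀.1, p₀.2.2)) :=
    (by fun_prop : Continuous fun q : Pt ρ => (q.1, q.2.2)).continuousAt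
  have hc2 : Tendsto (fun q : Pt ρ => ((q.1, p₀.2.1, q.2.2) : Pt ρ)) (𝓝 p₀) (𝓝 p₀) :=
    (by fun_prop : Continuous fun q : Pt ρ => ((q.1, p₀.2.1, q.2.2) : Pt ρ)).continuousAt
  filter_upwards [hc1.eventually (eventually_eventually_nhds.2 hvy), hc1.eventually hyt,
    hc2.eventually hv.eventually_differentiableAt] with q h1 h2 h3
  have h4 := hasDerivAt_pdT h3
  have h5 : (fun t => v (t, p₀.2.1, q.2.2)) =ᶠ[𝓝 q.1] fun t => y (t, q.2.2) := by
    have hc : Tendsto (fun t : ℝ => (t, q.2.2)) (𝓝 q.1) (𝓝 (q.1, q.2.2)) :=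
      (by fun_prop : Continuous fun t : ℝ => (t, q.2.2)).continuousAt
    exact hc.eventually h1
  have h6 := h4.unique (h2.congr_of_eventuallyEq h5)
  intro b
  rw [h6, ← h1.self_of_nhds]
  rfl

/-- If `v` and `v'` solve the initial system and correspond to the same `θ`, then the function `G`
in `𝓘' = G(t, 𝓘)` does not depend on `t`, since the derivatives of both `v` and `v'` with respect
to `t̃` are determined by `θ`. -/
theorem reparametrized_of_solvesInitialSystem {E : EvolutionEquation r} {p₀ : Pt ρ}
    {θ I v I' v' : Pt ρ → (Fin ρ → ℝ)} (hθ : SmoothNear θ p₀) (hI : SmoothNear I p₀)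
    (hv : SmoothNear v (hodographMap I p₀)) (hI' : SmoothNear I' p₀)
    (hv' : SmoothNear v' (hodographMap I' p₀)) (hS : DiffSubstitution I θ p₀)
    (hH : Hodograph I v p₀) (hS' : DiffSubstitution I' θ p₀) (hH' : Hodograph I' v' p₀)
    (h : SolvesInitialSystem E v (hodographMap I p₀))
    (h' : SolvesInitialSystem E v' (hodographMap I' p₀)) :
    Reparametrized (tildeU v) (tildeU v') (hodographMap I p₀) (hodographMap I' p₀) := by
  obtain ⟨G, hG, hGdet, hGeq⟩ := hS.gaugeRelated hI hI' hS'
  have hη : SmoothNear (lastComp θ) (hodographMap v (hodographMap I p₀)) := by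
    rw [hH.apply_base]; exact hθ.lastComp
  have hη' : SmoothNear (lastComp θ) (hodographMap v' (hodographMap I' p₀)) := by
    rw [hH'.apply_base]; exact hθ.lastComp
  have ht := (h.1.solvesJetODE hv ((hH.diffSubstitution_iff hI hv).1 hS)).solvesTimeODE hv hη h.2
  have ht' := (h'.1.solvesJetODE hv' ((hH'.diffSubstitution_iff hI' hv').1 hS')).solvesTimeODE
    hv' hη' h'.2
  let F : Pt ρ → (Fin ρ → ℝ) := fun q => G (q.1, q.2.2)
  have hF : SmoothNear F (hodographMap I p₀) :=
    hG.comp_of_eq ((contDiff_fst.prodMk (contDiff_snd.comp contDiff_snd)).smoothNear _) rfl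
  have hF0 : hodographMap F (hodographMap I p₀) = hodographMap I' p₀ :=
    Prod.ext rfl (Prod.ext rfl hGeq.self_of_nhds.symm)
  have hFt : Tendsto (hodographMap F) (𝓝 (hodographMap I p₀)) (𝓝 (hodographMap I' p₀)) := by
    have := hF.hodographMap.continuousAt
    rwa [ContinuousAt, hF0] at this
  have hvv' : ∀ᶠ q in 𝓝 (hodographMap I p₀), v' (hodographMap F q) = v q := by
    filter_upwards [(hH.tendsto hv).eventually hGeq, (hH.tendsto hv).eventually hH'.1, hH.2]
      with q h1 h2 h3
    have h4 : hodographMap I' (hodographMap v q) = hodographMap F q := by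
      have h5 : I (hodographMap v q) = q.2.2 := congrArg (fun z => z.2.2) h3
      rw [h5] at h1
      exact Prod.ext rfl (Prod.ext rfl h1)
    rw [h4] at h2
    exact congrArg (fun z => z.2.2) h2
  have hF_pdT : ∀ᶠ q in 𝓝 (hodographMap I p₀), pdT F q = 0 := by
    filter_upwards [eventually_eventually_nhds.2 hvv', ht, hFt.eventually ht',
      hF.eventually_differentiableAt, hFt.eventually hv'.eventually_differentiableAt,
      hFt.eventually (hH'.eventually_jac_mul_jac hI' hv')] with q h1 h2 h3 h4 h5 h6
    have h7 : hodographMap v' (hodographMap F q) = hodographMap v q :=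
      Prod.ext rfl (Prod.ext rfl h1.self_of_nhds)
    have h8 : pdT v q = pdT v' (hodographMap F q) :=
      funext fun b => by rw [h2 b, h3 b, h7]
    have h9 := pdT_comp_hodographMap h5 h4
    rw [pdT_congr h1, h8, left_eq_add, sum_smul_pdU_eq_jac_mulVec] at h9
    rw [← Matrix.one_mulVec (pdT F q), ← h6, ← Matrix.mulVec_mulVec, h9, Matrix.mulVec_zero]
  have hζ : ContDiff ℝ ∞ fun k : Fin ρ → ℝ => (p₀.1, k) := contDiff_const.prodMk contDiff_id
  refine ⟨fun k => G (p₀.1, k), hG.comp_of_eq (hζ.smoothNear _) rfl, hGeq.self_of_nhds.symm,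
    hGdet, ?_⟩
  filter_upwards [hvv', hF.eventually_eq_of_pdT_eq_zero hF_pdT] with q h1 h2
  have h3 : hodographMap F q = (q.1, q.2.1, G (p₀.1, q.2.2)) := Prod.ext rfl (Prod.ext rfl h2)
  rw [h3] at h1
  exact congrFun h1 0

end Families

theorem mainTheorem2 {r ρ : ℕ} (hr : 1 ≤ r) [NeZero ρ] (E : EvolutionEquation r) :
    -- the differential substitution: every tuple `θ` is locally of the form `-Ψ⁻¹ 𝓘_x`, and
    -- `𝓘` is determined by `θ` up to `𝓘 → G(t, 𝓘)`
    (∀ (p₀ : Pt ρ) (θ : Pt ρ → (Fin ρ → ℝ)), SmoothNear θ p₀ →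
      (∃ I : Pt ρ → (Fin ρ → ℝ), SmoothNear I p₀ ∧ DiffSubstitution I θ p₀) ∧
      ∀ I I' : Pt ρ → (Fin ρ → ℝ), SmoothNear I p₀ → SmoothNear I' p₀ →
        DiffSubstitution I θ p₀ → (DiffSubstitution I' θ p₀ ↔ GaugeRelated I I' p₀)) ∧
    -- the hodograph transformation is locally defined for every `𝓘` with `det Ψ ≠ 0`
    (∀ (p₀ : Pt ρ) (I : Pt ρ → (Fin ρ → ℝ)), SmoothNear I p₀ → (jac I p₀).det ≠ 0 →
      ∃ v : Pt ρ → (Fin ρ → ℝ), SmoothNear v (hodographMap I p₀) ∧ Hodograph I v p₀) ∧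
    -- the inverse hodograph transformation followed by the substitution is locally defined for
    -- every `v` with nonzero Jacobian with respect to the parameters
    (∀ (q₀ : Pt ρ) (v : Pt ρ → (Fin ρ → ℝ)), SmoothNear v q₀ → (jac v q₀).det ≠ 0 →
      ∃ I θ : Pt ρ → (Fin ρ → ℝ),
        SmoothNear I (hodographMap v q₀) ∧ SmoothNear θ (hodographMap v q₀) ∧
        hodographMap I (hodographMap v q₀) = q₀ ∧
        Hodograph I v (hodographMap v q₀) ∧ DiffSubstitution I θ (hodographMap v q₀)) ∧
    -- the composition of the two transformations relates the two systems
    (∀ (p₀ : Pt ρ) (θ I v : Pt ρ → (Fin ρ → ℝ)),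
      SmoothNear θ p₀ → SmoothNear I p₀ → SmoothNear v (hodographMap I p₀) →
      DiffSubstitution I θ p₀ → Hodograph I v p₀ →
      (AlgebraicEqs θ p₀ ↔ DerivativeEqs v (hodographMap I p₀)) ∧
      (SolvesInitialSystem E v (hodographMap I p₀) → SolvesDeterminingSystem E θ p₀) ∧
      (SolvesDeterminingSystem E θ p₀ →
        ∃ I' v' : Pt ρ → (Fin ρ → ℝ),
          SmoothNear I' p₀ ∧ SmoothNear v' (hodographMap I' p₀) ∧
          GaugeRelated I I' p₀ ∧ DiffSubstitution I' θ p₀ ∧ Hodograph I' v' p₀ ∧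
          SolvesInitialSystem E v' (hodographMap I' p₀))) ∧
    -- parametric families of solutions that correspond to the same `θ` differ only by their
    -- parametrization
    (∀ (p₀ : Pt ρ) (θ I v I' v' : Pt ρ → (Fin ρ → ℝ)),
      SmoothNear θ p₀ → SmoothNear I p₀ → SmoothNear v (hodographMap I p₀) →
      SmoothNear I' p₀ → SmoothNear v' (hodographMap I' p₀) →
      DiffSubstitution I θ p₀ → Hodograph I v p₀ →
      DiffSubstitution I' θ p₀ → Hodograph I' v' p₀ →
      SolvesInitialSystem E v (hodographMap I p₀) →
      SolvesInitialSystem E v' (hodographMap I' p₀) →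
      Reparametrized (tildeU v) (tildeU v') (hodographMap I p₀) (hodographMap I' p₀)) := by
  refine ⟨fun p₀ θ hθ => ⟨?_, fun I I' hI hI' h => ⟨h.gaugeRelated hI hI', fun hG =>
    hG.diffSubstitution hI h⟩⟩, fun p₀ I hI hdet => hI.exists_hodograph hdet, ?_, ?_, ?_⟩
  · -- `𝓘` consists of the initial values of the integral curves of `∂_x + ∑ θ^b ∂_{u_{b-1}}`
    obtain ⟨v, hv, hv₀, hdet, hvx, -⟩ := hθ.exists_normalized_family (y := fun k => k.2)
      (contDiff_snd.smoothNear _) (Eventually.of_forall fun _ => rfl)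
    obtain ⟨I, hI, hI₀, hH⟩ := hv.exists_inverse_hodograph hdet
    rw [hv₀] at hH hI hI₀
    exact ⟨I, hI, (hH.diffSubstitution_iff hI (by rwa [hI₀])).2 (by rwa [hI₀])⟩
  · intro q₀ v hv hdet
    obtain ⟨I, hI, hI₀, hH⟩ := hv.exists_inverse_hodograph hdet
    have hθ : SmoothNear (fun p => pdX v (hodographMap I p)) (hodographMap v q₀) :=
      hv.pdX.comp_of_eq hI.hodographMap hI₀
    refine ⟨I, fun p => pdX v (hodographMap I p), hI, hθ, hI₀, hH,
      (hH.diffSubstitution_iff hI (by rwa [hI₀])).2 ?_⟩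
    filter_upwards [hH.2] with q hq
    rw [hq]
  · intro p₀ θ I v hθ hI hv hS hH
    have hvx := (hH.diffSubstitution_iff hI hv).1 hS
    refine ⟨hH.algebraicEqs_iff hI hv hvx, fun h => ?_, fun h => ?_⟩
    · have hη : SmoothNear (lastComp θ) (hodographMap v (hodographMap I p₀)) := by
        rw [hH.apply_base]; exact hθ.lastComp
      exact ⟨(hH.algebraicEqs_iff hI hv hvx).2 h.1, hH.eventually_of_comp hI
        ((h.1.solvesJetODE hv hvx).eventually_determiningEqAt hv hη h.2)⟩
    · obtain ⟨v', hv', hv₀, hdet, hvx', hsol⟩ := h.exists_family hθ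
      obtain ⟨I', hI', hI₀, hH'⟩ := hv'.exists_inverse_hodograph hdet
      rw [hv₀] at hH' hI' hI₀
      have hv'' : SmoothNear v' (hodographMap I' p₀) := by rwa [hI₀]
      have hvx'' : ∀ᶠ q in 𝓝 (hodographMap I' p₀), pdX v' q = θ (hodographMap v' q) := by
        rwa [hI₀]
      have hS' := (hH'.diffSubstitution_iff hI' hv'').2 hvx''
      exact ⟨I', v', hI', hv'', hS.gaugeRelated hI hI' hS', hS', hH',
        by rwa [hI₀]⟩
  · intro p₀ θ I v I' v' hθ hI hv hI' hv' hS hH hS' hH' h h'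
    exact reparametrized_of_solvesInitialSystem hθ hI hv hI' hv' hS hH hS' hH' h h'
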